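/- **Setting.** Let $d\in\{2,3\}$, let $\widehat\Omega\subset\mathbb R^d$ be a bounded connected Lipschitz domain, and let $F:\widehat\Omega\to\Omega$ be a bi-Lipschitz mapping onto an open set $\Omega=F(\widehat\Omega)$ with $\det(DF)>0$ a.e. Write $(\cdot,\cdot)_\omega$ and $\|\cdot\|_\omega$ for the inner product and norm of $L^2(\omega)$, and $$\widetilde\Phi(\widehat q)=\big(\det(DF)^{-1}\,\widehat q\big)\circ F^{-1}.$$ For a space $Q$ of $L^2$-functions on $\omega\subseteq\Omega$ put $\widehat Q=\widetilde\Phi^{-1}(Q)$; for $g\in L^2(\omega)$, $\Upsilon_Q g\in Q$ denotes the Petrov–Galerkin projection, i.e. $(\Upsilon_Q g,t)_\omega=(g,t)_\omega$ for all $t\in\widehat Q\circ F^{-1}$. Let $f\in L^2(\Omega)$, let $V_h$ be a subspace of $H^1_0(\Omega)$, and let $u_h\in V_h$ satisfy $(\nabla u_h,\nabla v_h)_\Omega=(f,v_h)_\Omega$ for all $v_h\in V_h$. *Partitions of unity.* Let $(\psi_a)_{a\in\mathcal V_h}$ be a finite family in $W^{1,\infty}(\Omega)$ with $\sum_a\psi_a=1$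 in $\Omega$, such that every $\psi_a$ that belongs to $H^1_0(\Omega)$ belongs to $V_h$, and such that the interior $\omega_a$ of the support of $\psi_a$ is a connected Lipschitz domain. For each $a$ let $(\psi_b)_{b\in\mathcal V_h^a}$ be a finite family in $W^{1,\infty}(\omega_a)$ with $\sum_b\psi_b=1$ in $\omega_a$, such that the interior $\omega_b$ of the support of $\psi_b$ is a connected Lipschitz domain. In products $\psi_a\psi_b$ the function $\psi_b$ is extended by zero to $\Omega$; zero sets on boundaries refer to continuous extensions from the patch. *Local spaces.* Let - $H^1_*(\omega_a)=\{v\in H^1(\omega_a):(v,1)_{\omega_a}=0\}$ if $\psi_a\in H^1_0(\Omega)$, and $H^1_*(\omega_a)=\{v\in H^1(\omega_a): v=0\text{ on }\partial\omega_a\setminus\psi_a^{-1}(\{0\})\}$ otherwise; - $L^2_*(\omega_b)=\{q\in L^2(\omega_b):(q,1)_{\omega_b}=0\}$ if $\psi_a\psi_b\in H^1_0(\Omega)$, and $L^2_*(\omega_b)=L^2(\omega_b)$ otherwise; - $H_0(\mathrm{div},\omega_b)$ be the set of $v\in H(\mathrm{div},\omega_b)$ with $v\cdot n=0$ on $\Gamma$,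 where $\Gamma=\partial\omega_b$ if $\psi_a\psi_b\in H^1_0(\Omega)$ and $\Gamma=\partial\omega_b\cap(\psi_a\psi_b)^{-1}(\{0\})$ otherwise. Here $v\cdot n=0$ on $\Gamma$ means $(v,\nabla\varphi)_{\omega_b}+(\nabla\cdot v,\varphi)_{\omega_b}=0$ for all $\varphi\in H^1(\omega_b)$ with zero trace on $\partial\omega_b\setminus\Gamma$. Let $V_h^a\subset H^1_*(\omega_a)$ be finite-dimensional subspaces such that, for every $b\in\mathcal V_h^a$ with $\psi_a\psi_b\in H^1_0(\Omega)$, $\psi_b\in V_h^a+\mathbb R$ if $\psi_a\in H^1_0(\Omega)$, and $\psi_b\in V_h^a$ otherwise. Let $Q_h^{a,b}\subset L^2_*(\omega_b)$ and $\boldsymbol V_h^{a,b}\subset H_0(\mathrm{div},\omega_b)$ be finite-dimensional subspaces with $\nabla\cdot\boldsymbol V_h^{a,b}=Q_h^{a,b}$, and let $Q_h\subset L^2(\Omega)$ be a subspace such that, for all $a,b$, $Q_h|_{\omega_b}\subseteq Q_h^{a,b}+\widetilde\Phi(\mathbb R)$ if $\psi_a\psi_b\in H^1_0(\Omega)$,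 and $Q_h|_{\omega_b}\subseteq Q_h^{a,b}$ otherwise. *Flux.* For each $a$ let $r_h^a\in V_h^a$ satisfy $$(\nabla r_h^a,\nabla v_h)_{\omega_a}=(f,v_h\psi_a)_{\omega_a}-(\nabla u_h,\nabla(v_h\psi_a))_{\omega_a}\qquad\text{for all }v_h\in V_h^a.$$ For each $a,b$ let $\sigma_h^{a,b}$ be the minimizer of $\|v_h+\psi_b(\psi_a\nabla u_h+\nabla r_h^a)\|_{\omega_b}$ over all $v_h\in\boldsymbol V_h^{a,b}$ with $$\nabla\cdot v_h=\Upsilon_{Q_h^{a,b}}\big(f\psi_a\psi_b-\nabla u_h\cdot\nabla(\psi_a\psi_b)-\nabla r_h^a\cdot\nabla\psi_b\big).$$ Extend $\sigma_h^{a,b}$ by zero to $\Omega$ and put $\sigma_h=\sum_{a\in\mathcal V_h}\sum_{b\in\mathcal V_h^a}\sigma_h^{a,b}$. **Lemma 7.5.** It holds that $\sigma_h\in H(\mathrm{div},\Omega)$ and $$(\nabla\cdot\sigma_h,q_h)_\Omega=(f,q_h)_\Omega\qquad\text{for all }q_h\in\widehat Q_h\circ F^{-1},$$ or, equivalently, $\Upsilon_{Q_h}(f-\nabla\cdot\sigma_h)=0$.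 -/

import Mathlib

open MeasureTheory Set Filter Topology

noncomputable section

namespace Equilibration

/-! ## Lebesgue and Sobolev spaces on subsets of `ℝᵈ` -/

/-- The Euclidean space `ℝᵈ`. -/
abbrev Rd (d : ℕ) : Type := EuclideanSpace ℝ (Fin d)

variable {d : ℕ}

/-- `L²(ω)`. -/
abbrev L2 (ω : Set (Rd d)) : Type := Lp ℝ 2 (volume.restrict ω)

/-- `[L²(ω)]ᵈ`. -/
abbrev L2V (ω : Set (Rd d)) : Type := Lp (Rd d) 2 (volume.restrict ω)

/-- Pairs consisting of a scalar field and a vector field in `L²`; the elements `v` of `H¹(ω)` are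
represented by the pairs `(v, ∇v)`. -/
abbrev GradPair (ω : Set (Rd d)) : Type := L2 ω × L2V ω

/-- Pairs consisting of a vector field and a scalar field in `L²`; the elements `v` of `H(div,ω)`
are represented by the pairs `(v, ∇·v)`. -/
abbrev FluxPair (ω : Set (Rd d)) : Type := L2V ω × L2 ω

/-- `φ ∈ C_c^∞(ω)`. -/
structure IsTest (ω : Set (Rd d)) (φ : Rd d → ℝ) : Prop where
  smooth : ContDiff ℝ ((⊤ : ℕ∞) : WithTop ℕ∞) φ
  compact : HasCompactSupport φ
  subset : tsupport φ ⊆ ω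

/-- `G` is the weak gradient of `u` on the open set `ω`. -/
structure HasWeakGrad (ω : Set (Rd d)) (u : Rd d → ℝ) (G : Rd d → Rd d) : Prop where
  fun_loc : LocallyIntegrableOn u ω
  grad_loc : LocallyIntegrableOn G ω
  parts : ∀ φ, IsTest ω φ → ∫ x in ω, u x • gradient φ x = - ∫ x in ω, φ x • G x

open Classical in
/-- The weak gradient `∇u` on `ω` of a weakly differentiable function (unique almost everywhere
in `ω`). -/
def wgrad (ω : Set (Rd d)) (u : Rd d → ℝ) : Rd d → Rd d :=
  if h : ∃ G, HasWeakGrad ω u G then h.choose else 0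

/-- `u ∈ W^{1,∞}(ω)`, with `u` the continuous representative. -/
structure MemW1inf (ω : Set (Rd d)) (u : Rd d → ℝ) : Prop where
  cont : ContinuousOn u ω
  bdd : MemLp u ⊤ (volume.restrict ω)
  grad : ∃ G, HasWeakGrad ω u G ∧ MemLp G ⊤ (volume.restrict ω)

/-- `H¹(ω)`, as the set of pairs `(v, ∇v)`. -/
def H1 (ω : Set (Rd d)) : Set (GradPair ω) :=
  {p | HasWeakGrad ω p.1 p.2}

/-- `H₀¹(ω)`, the closure of `C_c^∞(ω)` in the `H¹`-norm, as a set of pairs `(v, ∇v)`. -/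
def H10 (ω : Set (Rd d)) : Set (GradPair ω) :=
  closure {p | ∃ φ, IsTest ω φ ∧ p.1 =ᵐ[volume.restrict ω] φ ∧
    p.2 =ᵐ[volume.restrict ω] gradient φ}

/-- The function `u` belongs to `H₀¹(ω)`. -/
def MemH10 (ω : Set (Rd d)) (u : Rd d → ℝ) : Prop :=
  ∃ p ∈ H10 ω, p.1 =ᵐ[volume.restrict ω] u

/-- `H(div,ω)`, as the set of pairs `(v, ∇·v)`. -/
def Hdiv (ω : Set (Rd d)) : Set (FluxPair ω) :=
  {p | ∀ φ, IsTest ω φ →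
    ∫ x in ω, inner ℝ (p.1 x) (gradient φ x) = - ∫ x in ω, p.2 x * φ x}

/-- `v = 0` on the part `S` of the boundary of the Lipschitz domain `ω` in the sense of traces: at
almost every point `x ∈ S` (for the surface measure) the trace of `v`, which is the limit of the
averages of `v` over `B(x,r) ∩ ω`, vanishes. -/
def TraceZeroOn (ω S : Set (Rd d)) (v : Rd d → ℝ) : Prop :=
  ∀ᵐ x ∂(Measure.hausdorffMeasure ((d : ℝ) - 1) : Measure (Rd d)), x ∈ S →
    Tendsto (fun r : ℝ => ⨍ y in Metric.ball x r ∩ ω, |v y|) (𝓝[>] 0) (𝓝 0)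

/-- The fields `v ∈ H(div,ω)` with `v·n = 0` on the part `Γ` of the boundary of `ω`: the normal trace
`φ ↦ ∫_ω v·∇φ + (∇·v) φ` vanishes for all `φ ∈ H¹(ω)` with zero trace on `∂ω \ Γ`. -/
def HdivZero (ω Γ : Set (Rd d)) : Set (FluxPair ω) :=
  {p | p ∈ Hdiv ω ∧ ∀ q ∈ H1 ω, TraceZeroOn ω (frontier ω \ Γ) q.1 →
    ∫ x in ω, (inner ℝ (p.1 x) (q.2 x) + p.2 x * q.1 x) = 0}

/-- A bounded connected (strongly) Lipschitz domain: an open set that lies locally, in suitable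
orthonormal coordinates, on one side of the graph of a Lipschitz function. The vector `ν` is the
last coordinate direction, and `γ` is evaluated on its orthogonal complement only. -/
structure IsLipschitzDomain (ω : Set (Rd d)) : Prop where
  isOpen : IsOpen ω
  isBounded : Bornology.IsBounded ω
  isConnected : IsConnected ω
  graph : ∀ x ∈ frontier ω, ∃ r > 0, ∃ ν : Rd d, ‖ν‖ = 1 ∧ ∃ γ : Rd d → ℝ,
    (∃ K, LipschitzWith K γ) ∧ ∀ y ∈ Metric.ball x r,
      (y ∈ ω ↔ γ (y - (inner ℝ ν y : ℝ) • ν) < inner ℝ ν y)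

/-! ## Patches and patchwise Sobolev spaces -/

/-- The interior of the support of a function `u` defined on the open set `D`. -/
def patch (D : Set (Rd d)) (u : Rd d → ℝ) : Set (Rd d) :=
  D ∩ interior (closure {x ∈ D | u x ≠ 0})

/-- The small patch `ω_b`, where `u = ψ_a` is defined on `Ω` and `w = ψ_b` on the large patch
`ω_a`. -/
abbrev smallPatch (Ω : Set (Rd d)) (u w : Rd d → ℝ) : Set (Rd d) :=
  patch (patch Ω u) w

/-- The product `ψ_a ψ_b`, where `w = ψ_b` is extended by zero from `ω_a` to `Ω`. -/
def extProd (Ω : Set (Rd d)) (u w : Rd d → ℝ) : Rd d → ℝ :=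
  fun x => u x * (patch Ω u).indicator w x

/-- The points of `∂ω` at which the continuous extension of `u` from `ω` vanishes. -/
def bdryZero (ω : Set (Rd d)) (u : Rd d → ℝ) : Set (Rd d) :=
  {x ∈ frontier ω | Tendsto u (𝓝[ω] x) (𝓝 0)}

/-- `H¹_*(ω_a)` for the large patch `ω_a` of `u = ψ_a`. -/
def H1star (Ω : Set (Rd d)) (u : Rd d → ℝ) : Set (GradPair (patch Ω u)) :=
  {p | p ∈ H1 (patch Ω u) ∧
    (MemH10 Ω u → ∫ x in patch Ω u, p.1 x = 0) ∧
    (¬ MemH10 Ω u →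
      TraceZeroOn (patch Ω u) (frontier (patch Ω u) \ bdryZero (patch Ω u) u) p.1)}

/-- `L²_*(ω_b)` for the small patch `ω_b` of `u = ψ_a`, `w = ψ_b`. -/
def L2star (Ω : Set (Rd d)) (u w : Rd d → ℝ) : Set (L2 (smallPatch Ω u w)) :=
  {q | MemH10 Ω (extProd Ω u w) → ∫ x in smallPatch Ω u w, q x = 0}

open Classical in
/-- The part of `∂ω_b` on which the normal component vanishes in `H₀(div,ω_b)`. -/
def neumannPart (Ω : Set (Rd d)) (u w : Rd d → ℝ) : Set (Rd d) :=
  if MemH10 Ω (extProd Ω u w) then frontier (smallPatch Ω u w)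
  else bdryZero (smallPatch Ω u w) (extProd Ω u w)

/-- `H₀(div,ω_b)` for the small patch `ω_b` of `u = ψ_a`, `w = ψ_b`. -/
def H0div (Ω : Set (Rd d)) (u w : Rd d → ℝ) : Set (FluxPair (smallPatch Ω u w)) :=
  HdivZero (smallPatch Ω u w) (neumannPart Ω u w)

/-! ## Parametrization, scalar Piola transform and Petrov–Galerkin projection -/

/-- `F` is a bi-Lipschitz mapping with positive Jacobian determinant from the bounded connected
Lipschitz domain `Ω̂ = F.source` onto `Ω = F.target`. -/
structure IsParametrization (F : OpenPartialHomeomorph (Rd d) (Rd d)) : Prop where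
  domain : IsLipschitzDomain F.source
  lipschitz : ∃ K, LipschitzOnWith K F F.source
  lipschitz_symm : ∃ K, LipschitzOnWith K F.symm F.target
  det_pos : ∀ᵐ y ∂(volume.restrict F.source), 0 < (fderiv ℝ F y).det

/-- The scalar Piola transform `(det(DF)⁻¹ q̂) ∘ F⁻¹`. -/
def scalarPiola (F : OpenPartialHomeomorph (Rd d) (Rd d)) (qhat : Rd d → ℝ) : Rd d → ℝ :=
  fun x => (fderiv ℝ F (F.symm x)).det⁻¹ * qhat (F.symm x)

/-- The test space `Q̂ ∘ F⁻¹` of a space `Q ⊆ L²(ω)`, where `Q̂` is the preimage of `Q` under the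
scalar Piola transform. -/
def testSpace (F : OpenPartialHomeomorph (Rd d) (Rd d)) (ω : Set (Rd d)) (Q : Set (L2 ω)) :
    Set (Rd d → ℝ) :=
  {t | ∃ qhat : Rd d → ℝ, (∃ q ∈ Q, scalarPiola F qhat =ᵐ[volume.restrict ω] q) ∧
    t =ᵐ[volume.restrict ω] qhat ∘ F.symm}

/-- `p` is the Petrov–Galerkin projection of `g` into `Q` with the test space `Q̂ ∘ F⁻¹`. -/
def IsProj (F : OpenPartialHomeomorph (Rd d) (Rd d)) (ω : Set (Rd d)) (Q : Set (L2 ω))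
    (g : Rd d → ℝ) (p : L2 ω) : Prop :=
  p ∈ Q ∧ ∀ t ∈ testSpace F ω Q, ∫ x in ω, p x * t x = ∫ x in ω, g x * t x

open Classical in
/-- The space `Q_c`, which is `Q` on the small patch enriched, in the case `ψ_a ψ_b ∈ H₀¹(Ω)`, by
the scalar Piola transforms of the constants. -/
def enriched (F : OpenPartialHomeomorph (Rd d) (Rd d)) (u w : Rd d → ℝ)
    (Q : Set (L2 (smallPatch F.target u w))) : Set (L2 (smallPatch F.target u w)) :=
  if MemH10 F.target (extProd F.target u w) then
    {q | ∃ q₀ ∈ Q, ∃ c : ℝ, q =ᵐ[volume.restrict (smallPatch F.target u w)]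
      fun x => q₀ x + scalarPiola F (fun _ => c) x}
  else Q

/-! ## The abstract assumptions -/

variable {α : Type*} {β : α → Type*}

/-- Global partition of unity `(ψ_a)` on `Ω`, compatible with `V_h`. -/
structure IsGlobalPartition [Fintype α] (Ω : Set (Rd d)) (ψ : α → Rd d → ℝ)
    (Vh : Submodule ℝ (GradPair Ω)) : Prop where
  mem : ∀ a, MemW1inf Ω (ψ a)
  sum_eq_one : ∀ x ∈ Ω, ∑ a, ψ a x = 1
  patch_lipschitz : ∀ a, IsLipschitzDomain (patch Ω (ψ a))
  interior_mem : ∀ a, ∀ p ∈ H10 Ω, p.1 =ᵐ[volume.restrict Ω] ψ a → p ∈ Vh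

/-- Local partitions of unity `(ψ_b)` on the large patches `ω_a`, compatible with the local spaces
`V_h^a`. -/
structure IsLocalPartition [∀ a, Fintype (β a)] (Ω : Set (Rd d)) (ψ : α → Rd d → ℝ)
    (χ : ∀ a, β a → Rd d → ℝ) (Va : ∀ a, Submodule ℝ (GradPair (patch Ω (ψ a)))) : Prop where
  mem : ∀ a b, MemW1inf (patch Ω (ψ a)) (χ a b)
  sum_eq_one : ∀ a, ∀ x ∈ patch Ω (ψ a), ∑ b, χ a b x = 1
  patch_lipschitz : ∀ a b, IsLipschitzDomain (smallPatch Ω (ψ a) (χ a b))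
  finite : ∀ a, FiniteDimensional ℝ (Va a)
  subset : ∀ a, (Va a : Set (GradPair (patch Ω (ψ a)))) ⊆ H1star Ω (ψ a)
  hat_mem : ∀ a b, MemH10 Ω (extProd Ω (ψ a) (χ a b)) →
    ∃ v ∈ Va a, ∃ c : ℝ, (¬ MemH10 Ω (ψ a) → c = 0) ∧
      χ a b =ᵐ[volume.restrict (patch Ω (ψ a))] fun x => v.1 x + c

/-- The local spaces `Q_h^{a,b} ⊆ L²_*(ω_b)` and `V_h^{a,b} ⊆ H₀(div,ω_b)` and the global space
`Q_h ⊆ L²(Ω)`. -/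
structure IsCompatible (F : OpenPartialHomeomorph (Rd d) (Rd d)) (ψ : α → Rd d → ℝ)
    (χ : ∀ a, β a → Rd d → ℝ)
    (Q : ∀ a b, Submodule ℝ (L2 (smallPatch F.target (ψ a) (χ a b))))
    (V : ∀ a b, Submodule ℝ (FluxPair (smallPatch F.target (ψ a) (χ a b))))
    (Qh : Submodule ℝ (L2 F.target)) : Prop where
  finite_Q : ∀ a b, FiniteDimensional ℝ (Q a b)
  finite_V : ∀ a b, FiniteDimensional ℝ (V a b)
  subset_Q : ∀ a b, (Q a b : Set (L2 (smallPatch F.target (ψ a) (χ a b)))) ⊆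
    L2star F.target (ψ a) (χ a b)
  subset_V : ∀ a b, (V a b : Set (FluxPair (smallPatch F.target (ψ a) (χ a b)))) ⊆
    H0div F.target (ψ a) (χ a b)
  div_eq : ∀ a b, Prod.snd '' (V a b : Set (FluxPair (smallPatch F.target (ψ a) (χ a b)))) = Q a b
  restrict_subset : ∀ a b, ∀ q ∈ Qh, ∃ q' ∈ enriched F (ψ a) (χ a b) (Q a b),
    q =ᵐ[volume.restrict (smallPatch F.target (ψ a) (χ a b))] q'

/-! ## The equilibrated flux -/

/-- `u_h ∈ V_h` is the Galerkin approximation for the right-hand side `f`. -/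
def IsGalerkin (Ω : Set (Rd d)) (Vh : Submodule ℝ (GradPair Ω)) (f : L2 Ω) (uh : GradPair Ω) :
    Prop :=
  uh ∈ Vh ∧ ∀ v ∈ Vh, ∫ x in Ω, inner ℝ (uh.2 x) (v.2 x) = ∫ x in Ω, f x * v.1 x

/-- `r ∈ V_h^a` is the discrete residual lifting on the large patch of `u = ψ_a`. -/
def IsLifting (Ω : Set (Rd d)) (f : L2 Ω) (uh : GradPair Ω) (u : Rd d → ℝ)
    (Va : Submodule ℝ (GradPair (patch Ω u))) (r : GradPair (patch Ω u)) : Prop :=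
  r ∈ Va ∧ ∀ v ∈ Va, ∫ x in patch Ω u, inner ℝ (r.2 x) (v.2 x) =
    (∫ x in patch Ω u, f x * (v.1 x * u x)) -
    (∫ x in patch Ω u, inner ℝ (uh.2 x) (wgrad (patch Ω u) (fun y => v.1 y * u y) x))

/-- The function `f ψ_a ψ_b - ∇u_h·∇(ψ_a ψ_b) - ∇r·∇ψ_b` with `u = ψ_a`, `w = ψ_b`. -/
def localSource (Ω : Set (Rd d)) (f : L2 Ω) (uh : GradPair Ω) (u w : Rd d → ℝ)
    (r : GradPair (patch Ω u)) : Rd d → ℝ := fun x =>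
  f x * (u x * w x) - inner ℝ (uh.2 x) (wgrad (patch Ω u) (fun y => u y * w y) x) -
    inner ℝ (r.2 x) (wgrad (patch Ω u) w x)

/-- `‖v + ψ_b (ψ_a ∇u_h + ∇r)‖` in `L²(ω_b)` with `u = ψ_a`, `w = ψ_b`. -/
def energy (Ω : Set (Rd d)) (uh : GradPair Ω) (u w : Rd d → ℝ) (r : GradPair (patch Ω u))
    (v : L2V (smallPatch Ω u w)) : ENNReal :=
  eLpNorm (fun x => v x + w x • (u x • uh.2 x + r.2 x)) 2 (volume.restrict (smallPatch Ω u w))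

/-- `s` is the equilibrated flux on the small patch: it minimizes the energy over all `v ∈ V` whose
divergence is the projection of the local source into `Q`. -/
def IsLocalFlux (F : OpenPartialHomeomorph (Rd d) (Rd d)) (f : L2 F.target)
    (uh : GradPair F.target) (u w : Rd d → ℝ) (r : GradPair (patch F.target u))
    (Q : Submodule ℝ (L2 (smallPatch F.target u w)))
    (V : Submodule ℝ (FluxPair (smallPatch F.target u w)))
    (s : FluxPair (smallPatch F.target u w)) : Prop :=
  s ∈ V ∧ IsProj F (smallPatch F.target u w) Q (localSource F.target f uh u w r) s.2 ∧
  ∀ v ∈ V, IsProj F (smallPatch F.target u w) Q (localSource F.target f uh u w r) v.2 →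
    energy F.target uh u w r s.1 ≤ energy F.target uh u w r v.1

/-- The patchwise fluxes `σ^a = ∑_b σ^{a,b}`, with `σ^{a,b}` extended by zero. -/
def patchFlux [∀ a, Fintype (β a)] (Ω : Set (Rd d)) (ψ : α → Rd d → ℝ)
    (χ : ∀ a, β a → Rd d → ℝ) (σ : ∀ a b, FluxPair (smallPatch Ω (ψ a) (χ a b))) (a : α) :
    Rd d → Rd d :=
  fun x => ∑ b, (smallPatch Ω (ψ a) (χ a b)).indicator (σ a b).1 x

/-- The global equilibrated flux `σ = ∑_a σ^a`. -/
def globalFlux [Fintype α] [∀ a, Fintype (β a)] (Ω : Set (Rd d)) (ψ : α → Rd d → ℝ)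
    (χ : ∀ a, β a → Rd d → ℝ) (σ : ∀ a b, FluxPair (smallPatch Ω (ψ a) (χ a b))) :
    Rd d → Rd d :=
  fun x => ∑ a, patchFlux Ω ψ χ σ a x

end Equilibration

end

open Equilibration

noncomputable section

namespace Equilibration

variable {d : ℕ} {ω : Set (Rd d)}

/-! ### Test functions -/

/-! Write `g_{ab}` for the source `f ψ_a ψ_b - ∇u_h·∇(ψ_a ψ_b) - ∇r_a·∇ψ_b` of the local problem.

Conformity: a local flux extended by zero has as divergence the zero extension of its own
divergence. A test function `φ` on `Ω` is admissible in the definition of the vanishing normal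
trace: a point of `∂ω_b` inside `Ω` lies in the Neumann part because `ψ_a ψ_b` tends to zero there,
and near a point outside `Ω` the function `φ` is zero (`integral_div_add_eq_zero`).

Divergence: let `t` be a global test function. On `ω_b` it is a local test function, up to an
additive constant `c` when `ψ_a ψ_b ∈ H₀¹(Ω)`. In that case the local divergence has mean zero by
the choice of the space, and `g_{ab}` has mean zero by `integral_localSource_eq_zero`: the residual
lifting is tested with `ψ_b` minus a constant, and the contribution of this constant is the Galerkin
residual of `ψ_a`. Hence the local constraint holds against `t` itself
(`integral_div_mul_eq_of_isProj`). Since `∑_b ψ_b = 1` and `∑_b ∇ψ_b = 0`, summing `g_{ab}` over `b`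
leaves `f ψ_a - ∇u_h·∇ψ_a`, and summing over `a` leaves `f` (`sum_sum_integral_localSource`).

Projection: an element `p` of `Q_h` orthogonal to the test space can be tested with `det(DF) p`,
where positivity of the determinant forces `p = 0`.

The analytic groundwork is a product rule for weak gradients, proved by mollification, and the fact
that patch boundaries are null sets, so that gradients vanish almost everywhere off the patches. -/

theorem integrableOn_smul_of_support {F : Type*} [NormedAddCommGroup F] [NormedSpace ℝ F]
    {K : Set (Rd d)} (hK : IsCompact K) (hKω : K ⊆ ω) (hω : IsOpen ω) {g : Rd d → ℝ}
    {f : Rd d → F} (hf : LocallyIntegrableOn f ω)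
    (hg : AEStronglyMeasurable g (volume.restrict K)) {C : ℝ} (hC : ∀ x, ‖g x‖ ≤ C)
    (h0 : ∀ x ∉ K, g x = 0) : IntegrableOn (fun x => g x • f x) ω := by
  refine IntegrableOn.of_forall_sdiff_eq_zero (s := K) ?_ hω.measurableSet
    fun x hx => by simp [h0 x hx.2]
  exact (hf.integrableOn_compact_subset hKω hK).bdd_smul C hg (ae_of_all _ hC)

theorem integrableOn_smul_of_support' {F : Type*} [NormedAddCommGroup F] [NormedSpace ℝ F]
    {K : Set (Rd d)} (hK : IsCompact K) (hKω : K ⊆ ω) (hω : IsOpen ω) {g : Rd d → F}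
    {f : Rd d → ℝ} (hf : LocallyIntegrableOn f ω)
    (hg : AEStronglyMeasurable g (volume.restrict K)) {C : ℝ} (hC : ∀ x, ‖g x‖ ≤ C)
    (h0 : ∀ x ∉ K, g x = 0) : IntegrableOn (fun x => f x • g x) ω := by
  refine IntegrableOn.of_forall_sdiff_eq_zero (s := K) ?_ hω.measurableSet
    fun x hx => by simp [h0 x hx.2]
  exact (hf.integrableOn_compact_subset hKω hK).smul_bdd C hg (ae_of_all _ hC)

theorem continuous_gradient {φ : Rd d → ℝ} (h : ContDiff ℝ 1 φ) : Continuous (gradient φ) :=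
  (InnerProductSpace.toDual ℝ (Rd d)).symm.continuous.comp (h.continuous_fderiv one_ne_zero)

theorem gradient_eq_zero_of_notMem_tsupport {φ : Rd d → ℝ} {x : Rd d} (hx : x ∉ tsupport φ) :
    gradient φ x = 0 := by
  rw [notMem_tsupport_iff_eventuallyEq] at hx
  rw [hx.gradient_eq]
  exact gradient_const x 0

namespace IsTest

variable {φ : Rd d → ℝ}

theorem mono {ω' : Set (Rd d)} (h : IsTest ω' φ) (hs : ω' ⊆ ω) : IsTest ω φ :=
  ⟨h.smooth, h.compact, h.subset.trans hs⟩

theorem contDiff_one (h : IsTest ω φ) : ContDiff ℝ 1 φ :=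
  h.smooth.of_le (by norm_cast)

theorem continuous (h : IsTest ω φ) : Continuous φ := h.smooth.continuous

theorem continuous_grad (h : IsTest ω φ) : Continuous (gradient φ) :=
  continuous_gradient h.contDiff_one

theorem compact_grad (h : IsTest ω φ) : HasCompactSupport (gradient φ) :=
  HasCompactSupport.intro h.compact.isCompact fun _ hx => gradient_eq_zero_of_notMem_tsupport hx

theorem eq_zero (h : IsTest ω φ) {x : Rd d} (hx : x ∉ ω) : φ x = 0 :=
  image_eq_zero_of_notMem_tsupport fun h' => hx (h.subset h')

theorem gradient_eq_zero (h : IsTest ω φ) {x : Rd d} (hx : x ∉ ω) : gradient φ x = 0 :=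
  gradient_eq_zero_of_notMem_tsupport fun h' => hx (h.subset h')

theorem bounded (h : IsTest ω φ) : ∃ C, ∀ x, ‖φ x‖ ≤ C :=
  h.compact.exists_bound_of_continuous h.continuous

theorem bounded_grad (h : IsTest ω φ) : ∃ C, ∀ x, ‖gradient φ x‖ ≤ C :=
  h.compact_grad.exists_bound_of_continuous h.continuous_grad

theorem integrable_smul {F : Type*} [NormedAddCommGroup F] [NormedSpace ℝ F] {f : Rd d → F}
    (h : IsTest ω φ) (hω : IsOpen ω) (hf : LocallyIntegrableOn f ω) :
    IntegrableOn (fun x => φ x • f x) ω := by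
  obtain ⟨C, hC⟩ := h.bounded
  exact integrableOn_smul_of_support h.compact.isCompact h.subset hω hf
    h.continuous.aestronglyMeasurable hC fun x hx => image_eq_zero_of_notMem_tsupport hx

theorem integrable_smul_grad {f : Rd d → ℝ}
    (h : IsTest ω φ) (hω : IsOpen ω) (hf : LocallyIntegrableOn f ω) :
    IntegrableOn (fun x => f x • gradient φ x) ω := by
  obtain ⟨C, hC⟩ := h.bounded_grad
  exact integrableOn_smul_of_support' h.compact.isCompact h.subset hω hf
    h.continuous_grad.aestronglyMeasurable hC fun x hx => gradient_eq_zero_of_notMem_tsupport hx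

theorem memLp (h : IsTest ω φ) (S : Set (Rd d)) : MemLp φ 2 (volume.restrict S) :=
  (h.continuous.memLp_of_hasCompactSupport h.compact).restrict S

theorem memLp_grad (h : IsTest ω φ) (S : Set (Rd d)) :
    MemLp (gradient φ) 2 (volume.restrict S) :=
  (h.continuous_grad.memLp_of_hasCompactSupport h.compact_grad).restrict S

end IsTest

theorem gradient_mul {φ η : Rd d → ℝ} {x : Rd d} (hφ : DifferentiableAt ℝ φ x)
    (hη : DifferentiableAt ℝ η x) :
    gradient (fun y => φ y * η y) x = φ x • gradient η x + η x • gradient φ x := by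
  simp only [gradient, fderiv_fun_mul hφ hη, map_add, map_smulₛₗ]
  simp

/-- Smooth functions are weakly differentiable. -/
theorem hasWeakGrad_of_contDiff (u : Rd d → ℝ) (hu : ContDiff ℝ 1 u) (ω : Set (Rd d)) :
    HasWeakGrad ω u (gradient u) where
  fun_loc := hu.continuous.locallyIntegrable.locallyIntegrableOn ω
  grad_loc := (continuous_gradient hu).locallyIntegrable.locallyIntegrableOn ω
  parts φ hφ := by
    rw [setIntegral_eq_integral_of_forall_compl_eq_zero
        (fun x hx => by simp [hφ.gradient_eq_zero hx]),
      setIntegral_eq_integral_of_forall_compl_eq_zero (fun x hx => by simp [hφ.eq_zero hx])]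
    have i1 : Integrable (fun x => u x • gradient φ x) :=
      (hu.continuous.smul hφ.continuous_grad).integrable_of_hasCompactSupport
        hφ.compact_grad.smul_left
    have i2 : Integrable (fun x => φ x • gradient u x) :=
      (hφ.continuous.smul (continuous_gradient hu)).integrable_of_hasCompactSupport
        hφ.compact.smul_right
    have i3 : Integrable (fun x => u x * φ x) :=
      (hu.continuous.mul hφ.continuous).integrable_of_hasCompactSupport hφ.compact.mul_left
    -- Pairing with a fixed direction `e` reduces the vector identity to scalar integration by parts
    -- for a directional derivative.
    refine ext_inner_left ℝ fun e => ?_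
    rw [inner_neg_right, ← integral_inner i1, ← integral_inner i2]
    have j1 := i1.const_inner (𝕜 := ℝ) e
    have j2 := i2.const_inner (𝕜 := ℝ) e
    have key := integral_mul_fderiv_eq_neg_fderiv_mul_of_integrable (μ := volume) (f := u)
      (g := φ) (v := e)
      (j2.congr (ae_of_all _ fun x => by
        simp only [inner_smul_right, inner_gradient_right, conj_trivial]; ring))
      (j1.congr (ae_of_all _ fun x => by
        simp only [inner_smul_right, inner_gradient_right, conj_trivial])) i3
      (fun x _ => hu.differentiable one_ne_zero x)
      (fun x _ => hφ.contDiff_one.differentiable one_ne_zero x)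
    simp only [inner_smul_right, inner_gradient_right, conj_trivial]
    rw [key]
    congr 1
    exact integral_congr_ae (ae_of_all _ fun x => mul_comm _ _)

theorem hasWeakGrad_const (c : ℝ) (ω : Set (Rd d)) : HasWeakGrad ω (fun _ => c) (fun _ => 0) := by
  have h := hasWeakGrad_of_contDiff (fun _ => c) contDiff_const ω
  rwa [gradient_fun_const'] at h

/-! ### Algebra of weak gradients -/

namespace HasWeakGrad

variable {u w : Rd d → ℝ} {G H : Rd d → Rd d}

theorem locallyIntegrableOn_congr {F : Type*} [NormedAddCommGroup F] {f g : Rd d → F}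
    (hω : IsOpen ω) (hf : LocallyIntegrableOn f ω) (h : f =ᵐ[volume.restrict ω] g) :
    LocallyIntegrableOn g ω := by
  rw [locallyIntegrableOn_iff hω.isLocallyClosed] at hf ⊢
  intro k hk hkc
  exact (hf k hk hkc).congr (ae_restrict_of_ae_restrict_of_subset hk h)

theorem congr (hω : IsOpen ω) (h : HasWeakGrad ω u G) (hu : u =ᵐ[volume.restrict ω] w)
    (hG : G =ᵐ[volume.restrict ω] H) : HasWeakGrad ω w H where
  fun_loc := locallyIntegrableOn_congr hω h.fun_loc hu
  grad_loc := locallyIntegrableOn_congr hω h.grad_loc hG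
  parts φ hφ := by
    have e1 : ∫ x in ω, w x • gradient φ x = ∫ x in ω, u x • gradient φ x :=
      integral_congr_ae (hu.mono fun x hx => by simp only [hx])
    have e2 : ∫ x in ω, φ x • H x = ∫ x in ω, φ x • G x :=
      integral_congr_ae (hG.mono fun x hx => by simp only [hx])
    rw [e1, e2, h.parts φ hφ]

theorem mono {ω' : Set (Rd d)} (h : HasWeakGrad ω u G) (hs : ω' ⊆ ω) : HasWeakGrad ω' u G where
  fun_loc := h.fun_loc.mono_set hs
  grad_loc := h.grad_loc.mono_set hs
  parts φ hφ := by
    have h1 := h.parts φ (hφ.mono hs)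
    rw [setIntegral_eq_integral_of_forall_compl_eq_zero
        (fun x hx => by simp [(hφ.mono hs).gradient_eq_zero hx]),
      setIntegral_eq_integral_of_forall_compl_eq_zero
        (fun x hx => by simp [(hφ.mono hs).eq_zero hx])] at h1
    rw [setIntegral_eq_integral_of_forall_compl_eq_zero
        (fun x hx => by simp [hφ.gradient_eq_zero hx]),
      setIntegral_eq_integral_of_forall_compl_eq_zero (fun x hx => by simp [hφ.eq_zero hx]), h1]

theorem add (hω : IsOpen ω) (h : HasWeakGrad ω u G) (h' : HasWeakGrad ω w H) :
    HasWeakGrad ω (fun x => u x + w x) (fun x => G x + H x) where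
  fun_loc := h.fun_loc.add h'.fun_loc
  grad_loc := h.grad_loc.add h'.grad_loc
  parts φ hφ := by
    simp only [add_smul, smul_add]
    rw [integral_add (hφ.integrable_smul_grad hω h.fun_loc)
        (hφ.integrable_smul_grad hω h'.fun_loc),
      integral_add (hφ.integrable_smul hω h.grad_loc) (hφ.integrable_smul hω h'.grad_loc),
      h.parts φ hφ, h'.parts φ hφ, neg_add]

theorem const_mul (h : HasWeakGrad ω u G) (c : ℝ) :
    HasWeakGrad ω (fun x => c * u x) (fun x => c • G x) where
  fun_loc x hx := by
    obtain ⟨s, hs, hi⟩ := h.fun_loc x hx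
    exact ⟨s, hs, hi.const_mul c⟩
  grad_loc x hx := by
    obtain ⟨s, hs, hi⟩ := h.grad_loc x hx
    exact ⟨s, hs, hi.smul c⟩
  parts φ hφ := by
    have e1 : ∀ x, (c * u x) • gradient φ x = c • (u x • gradient φ x) := fun x => mul_smul _ _ _
    have e2 : ∀ x, φ x • c • G x = c • (φ x • G x) := fun x => smul_comm _ _ _
    simp only [e1, e2]
    rw [integral_smul, integral_smul, h.parts φ hφ, smul_neg]

theorem sum (hω : IsOpen ω) {ι : Type*} (s : Finset ι) {u : ι → Rd d → ℝ}
    {G : ι → Rd d → Rd d} (h : ∀ i ∈ s, HasWeakGrad ω (u i) (G i)) :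
    HasWeakGrad ω (fun x => ∑ i ∈ s, u i x) (fun x => ∑ i ∈ s, G i x) := by
  classical
  induction s using Finset.induction_on with
  | empty => simpa using hasWeakGrad_const 0 ω
  | insert a s ha ih =>
    simp only [Finset.sum_insert ha]
    exact (h a (Finset.mem_insert_self a s)).add hω
      (ih fun i hi => h i (Finset.mem_insert_of_mem hi))

/-- The difference of the two gradients annihilates all test functions, so the fundamental lemma of
the calculus of variations applies. -/
theorem unique (hω : IsOpen ω) (h : HasWeakGrad ω u G) (h' : HasWeakGrad ω u H) :
    G =ᵐ[volume.restrict ω] H := by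
  have key := hω.ae_eq_zero_of_integral_contDiff_smul_eq_zero (μ := volume)
    (f := fun x => G x - H x) (h.grad_loc.sub h'.grad_loc) fun φ h1 h2 h3 => by
      have hφ : IsTest ω φ := ⟨h1, h2, h3⟩
      rw [← setIntegral_eq_integral_of_forall_compl_eq_zero (s := ω)
        (fun x hx => by simp [hφ.eq_zero hx])]
      simp only [smul_sub]
      rw [integral_sub (hφ.integrable_smul hω h.grad_loc) (hφ.integrable_smul hω h'.grad_loc),
        ← neg_neg (∫ x in ω, φ x • G x), ← h.parts φ hφ, h'.parts φ hφ, neg_neg, sub_self]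
  rw [EventuallyEq, ae_restrict_iff' hω.measurableSet]
  filter_upwards [key] with x hx hxω using sub_eq_zero.mp (hx hxω)

/-- `wgrad` is defined by choice; this is the way to replace it by a gradient computed by hand. -/
theorem wgrad_ae (hω : IsOpen ω) (h : HasWeakGrad ω u G) :
    wgrad ω u =ᵐ[volume.restrict ω] G := by
  have hex : ∃ G, HasWeakGrad ω u G := ⟨G, h⟩
  rw [wgrad, dif_pos hex]
  exact hex.choose_spec.unique hω h

theorem ae_eq_zero_of_eqOn_zero (hω : IsOpen ω) (h : HasWeakGrad ω u G)
    (h0 : ∀ x ∈ ω, u x = 0) : ∀ᵐ x ∂volume.restrict ω, G x = 0 :=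
  h.unique hω ((hasWeakGrad_const 0 ω).congr hω
    ((ae_restrict_iff' hω.measurableSet).2 (ae_of_all _ fun x hx => (h0 x hx).symm)) ae_eq_rfl)

end HasWeakGrad

/-! ### `H₀¹ ⊆ H¹` -/

theorem L2_locallyIntegrableOn {F : Type*} [NormedAddCommGroup F]
    (v : Lp F 2 (volume.restrict ω)) : LocallyIntegrableOn v ω :=
  locallyIntegrableOn_of_locallyIntegrable_restrict ((Lp.memLp v).locallyIntegrable one_le_two)

theorem mem_H1_iff {p : GradPair ω} : p ∈ H1 ω ↔
    ∀ φ, IsTest ω φ → ∫ x in ω, p.1 x • gradient φ x = - ∫ x in ω, φ x • p.2 x :=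
  ⟨fun h => h.parts, fun h => ⟨L2_locallyIntegrableOn _, L2_locallyIntegrableOn _, h⟩⟩

/-- Written as an `L²` inner product with a fixed element, the integral is visibly continuous in
`v`. This serves `isClosed_H1`. -/
theorem integral_smul_grad_inner {φ : Rd d → ℝ} (hω : IsOpen ω) (hφ : IsTest ω φ) (v : L2 ω)
    (e : Rd d) : inner ℝ e (∫ x in ω, v x • gradient φ x) =
      inner ℝ (((hφ.memLp_grad ω).const_inner (𝕜 := ℝ) e).toLp _) v := by
  rw [← integral_inner (hφ.integrable_smul_grad hω (L2_locallyIntegrableOn v)), L2.inner_def]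
  refine integral_congr_ae ?_
  filter_upwards [((hφ.memLp_grad ω).const_inner (𝕜 := ℝ) e).coeFn_toLp] with x hx
  rw [hx]
  simp [inner_smul_right]

theorem IsTest.memLp_smul_const {φ : Rd d → ℝ} (hφ : IsTest ω φ) (S : Set (Rd d)) (e : Rd d) :
    MemLp (fun x => φ x • e) 2 (volume.restrict S) :=
  ((hφ.continuous.smul continuous_const).memLp_of_hasCompactSupport
    hφ.compact.smul_right).restrict S

theorem integral_smul_inner {φ : Rd d → ℝ} (hω : IsOpen ω) (hφ : IsTest ω φ) (v : L2V ω)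
    (e : Rd d) : inner ℝ e (∫ x in ω, φ x • v x) =
      inner ℝ ((hφ.memLp_smul_const ω e).toLp _) v := by
  rw [← integral_inner (hφ.integrable_smul hω (L2_locallyIntegrableOn v)), L2.inner_def]
  refine integral_congr_ae ?_
  filter_upwards [(hφ.memLp_smul_const ω e).coeFn_toLp] with x hx
  rw [hx]
  simp [inner_smul_right, inner_smul_left]

/-- The definition of the weak gradient is a family of linear equations, one for each test function
and direction, each continuous in the pair. -/
theorem isClosed_H1 (hω : IsOpen ω) : IsClosed (H1 ω) := by
  have : H1 ω = ⋂ (φ : Rd d → ℝ) (hφ : IsTest ω φ) (e : Rd d), {p : GradPair ω |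
      (inner ℝ (((hφ.memLp_grad ω).const_inner (𝕜 := ℝ) e).toLp _) p.1 : ℝ) =
        - inner ℝ ((hφ.memLp_smul_const ω e).toLp _) p.2} := by
    ext p
    simp only [mem_iInter, mem_ofPred_eq, mem_H1_iff]
    refine forall₂_congr fun φ hφ => ?_
    simp only [← integral_smul_grad_inner hω hφ, ← integral_smul_inner hω hφ, ← inner_neg_right]
    exact ⟨fun h e => by rw [h], ext_inner_left ℝ⟩
  rw [this]
  refine isClosed_iInter fun φ => isClosed_iInter fun hφ => isClosed_iInter fun e => ?_
  exact isClosed_eq (continuous_const.inner continuous_fst)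
    (continuous_const.inner continuous_snd).neg

theorem IsTest.toLp_mem_H1 (hω : IsOpen ω) {φ : Rd d → ℝ} {S : Set (Rd d)} (hφ : IsTest S φ) :
    ((hφ.memLp ω).toLp φ, (hφ.memLp_grad ω).toLp (gradient φ)) ∈ H1 ω :=
  (hasWeakGrad_of_contDiff φ hφ.contDiff_one ω).congr hω (hφ.memLp ω).coeFn_toLp.symm
    (hφ.memLp_grad ω).coeFn_toLp.symm

/-- Consequently the second component of a pair in `H10` is the weak gradient of the first. -/
theorem H10_subset_H1 (hω : IsOpen ω) : H10 ω ⊆ H1 ω := by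
  refine closure_minimal ?_ (isClosed_H1 hω)
  rintro p ⟨φ, hφ, h1, h2⟩
  exact (hasWeakGrad_of_contDiff φ hφ.contDiff_one ω).congr hω h1.symm h2.symm

/-! ### Mollification and the product rule -/

theorem norm_mollify_le {F : Type*} [NormedAddCommGroup F] [NormedSpace ℝ F]
    (b : ContDiffBump (0 : Rd d))
    {g : Rd d → F} {C : ℝ} (hC : ∀ x, ‖g x‖ ≤ C) (x : Rd d) :
    ‖(convolution (b.normed volume) g (ContinuousLinearMap.lsmul ℝ ℝ) volume) x‖ ≤ C := by
  have h := norm_integral_le_of_norm_le (μ := volume) (f := fun t => b.normed volume t • g (x - t))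
    (g := fun t => b.normed volume t * C) (b.integrable_normed.mul_const C) (ae_of_all _ fun t => by
      rw [norm_smul, Real.norm_of_nonneg (b.nonneg_normed t)]
      exact mul_le_mul_of_nonneg_left (hC _) (b.nonneg_normed t))
  rw [integral_mul_const, b.integral_normed, one_mul] at h
  exact h

theorem mollify_eq_zero {F : Type*} [NormedAddCommGroup F] [NormedSpace ℝ F]
    (b : ContDiffBump (0 : Rd d))
    {g : Rd d → F} {K : Set (Rd d)} (h0 : ∀ x ∉ K, g x = 0) {δ : ℝ} (hδ : b.rOut ≤ δ) {x : Rd d}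
    (hx : x ∉ Metric.cthickening δ K) :
    (convolution (b.normed volume) g (ContinuousLinearMap.lsmul ℝ ℝ) volume) x = 0 := by
  refine integral_eq_zero_of_ae (ae_of_all _ fun t => ?_)
  by_cases ht : t ∈ Metric.ball (0 : Rd d) b.rOut
  · have : x - t ∉ K := fun hK => hx <| Metric.mem_cthickening_of_dist_le x (x - t) δ K hK <| by
      rw [dist_eq_norm, sub_sub_cancel]
      exact (mem_ball_zero_iff.1 ht).le.trans hδ
    simp [h0 _ this]
  · have : b.normed volume t = 0 := by
      rw [← Function.notMem_support, b.support_normed_eq]; exact ht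
    simp [this]

/-- The derivative falls on the kernel, and the reflected kernel `t ↦ b(x - t)` is itself a test
function for the weak gradient; the sign from the reflection cancels the one from integration by
parts. -/
theorem gradient_mollify (b : ContDiffBump (0 : Rd d)) {k : Rd d → ℝ} {M : Rd d → Rd d}
    (hk : Integrable k) (h : HasWeakGrad univ k M) (x : Rd d) :
    gradient (convolution (b.normed volume) k (ContinuousLinearMap.lsmul ℝ ℝ) volume) x =
      (convolution (b.normed volume) M (ContinuousLinearMap.lsmul ℝ ℝ) volume) x := by
  have hb : ContDiff ℝ ((⊤ : ℕ∞) : WithTop ℕ∞) (b.normed (volume : Measure (Rd d))) :=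
    b.contDiff_normed
  have hb1 : ContDiff ℝ 1 (b.normed (volume : Measure (Rd d))) := b.contDiff_normed
  have hbc := b.hasCompactSupport_normed (μ := (volume : Measure (Rd d)))
  set ζ : Rd d → ℝ := fun t => b.normed volume (x - t) with hζ
  have hζt : IsTest univ ζ := by
    refine ⟨hb.comp (contDiff_const.sub contDiff_id), ?_, subset_univ _⟩
    exact hbc.comp_homeomorph (Homeomorph.subLeft x)
  have hp := h.parts ζ hζt
  simp only [Measure.restrict_univ] at hp
  have hconv : (convolution (b.normed volume) M (ContinuousLinearMap.lsmul ℝ ℝ) volume) x =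
      ∫ t, ζ t • M t := by
    rw [convolution_eq_swap]; rfl
  rw [hconv, ← neg_neg (∫ t, ζ t • M t), ← hp]
  refine ext_inner_left ℝ fun e => ?_
  rw [inner_gradient_right, conj_trivial, ← convolution_flip,
    (hbc.hasFDerivAt_convolution_right _ hk.locallyIntegrable hb1 x).fderiv,
    convolution_precompR_apply _ hk.locallyIntegrable (hbc.fderiv ℝ)
      (hb1.continuous_fderiv one_ne_zero), inner_neg_right, ← integral_inner, ← integral_neg]
  · refine integral_congr_ae (ae_of_all _ fun t => ?_)
    have hd : fderiv ℝ ζ t e = - fderiv ℝ (b.normed volume) (x - t) e := by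
      have h1 : HasFDerivAt (fun t : Rd d => x - t) (-ContinuousLinearMap.id ℝ (Rd d)) t :=
        (hasFDerivAt_id t).const_sub x
      have h2 := ((hb1.differentiable one_ne_zero (x - t)).hasFDerivAt).comp t h1
      have h3 : fderiv ℝ ζ t = _ := h2.fderiv
      rw [h3]
      simp
    simp [inner_smul_right, inner_gradient_right, hd, mul_comm]
  · have := hζt.integrable_smul_grad isOpen_univ (hk.locallyIntegrable.locallyIntegrableOn univ)
    simpa using this

/-- A compactly supported bounded function with bounded weak gradient is a bounded
almost everywhere limit of test functions. -/
theorem exists_test_approx (hω : IsOpen ω) {K : Set (Rd d)} (hK : IsCompact K) (hKω : K ⊆ ω)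
    {k : Rd d → ℝ} {M : Rd d → Rd d} (hk : Integrable k) (hM : Integrable M)
    (h : HasWeakGrad univ k M) (hk0 : ∀ x ∉ K, k x = 0) {C : ℝ}
    (hkC : ∀ x, ‖k x‖ ≤ C) (hMC : ∀ x, ‖M x‖ ≤ C) :
    ∃ L, IsCompact L ∧ L ⊆ ω ∧ ∃ η : ℕ → Rd d → ℝ, (∀ n, IsTest ω (η n)) ∧
      (∀ n, ∀ x ∉ L, η n x = 0) ∧ (∀ n, ∀ x ∉ L, gradient (η n) x = 0) ∧
      (∀ n x, ‖η n x‖ ≤ C) ∧ (∀ n x, ‖gradient (η n) x‖ ≤ C) ∧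
      (∀ᵐ x, Tendsto (fun n => η n x) atTop (𝓝 (k x))) ∧
      (∀ᵐ x, Tendsto (fun n => gradient (η n) x) atTop (𝓝 (M x))) := by
  obtain ⟨δ, hδ, hδω⟩ := hK.exists_cthickening_subset_open hω hKω
  -- Outer radii at most `δ` keep all supports in one compact thickening of `K`; the fixed ratio 2
  -- of the radii gives almost everywhere convergence by Lebesgue differentiation.
  let b : ℕ → ContDiffBump (0 : Rd d) := fun n =>
    ⟨δ / (n + 1) / 2, δ / (n + 1), by positivity, half_lt_self (by positivity)⟩
  have hb : ∀ n, (b n).rOut ≤ δ := fun n => div_le_self hδ.le (by simp)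
  have hlim : Tendsto (fun n => (b n).rOut) atTop (𝓝 0) :=
    tendsto_const_div_atTop_nhds_zero_nat δ |>.comp (tendsto_add_atTop_nat 1) |>.congr
      fun n => by simp [b]
  have hratio : ∀ᶠ n in atTop, (b n).rOut ≤ 2 * (b n).rIn :=
    Eventually.of_forall fun n => by simp only [b]; linarith
  have ht : ∀ n, tsupport (convolution ((b n).normed volume) k
      (ContinuousLinearMap.lsmul ℝ ℝ) volume) ⊆ Metric.cthickening δ K := fun n =>
    closure_minimal (fun x hx => by
      by_contra hx'
      exact hx (mollify_eq_zero (b n) hk0 (hb n) hx')) Metric.isClosed_cthickening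
  refine ⟨Metric.cthickening δ K, hK.cthickening, hδω,
    fun n => convolution ((b n).normed volume) k (ContinuousLinearMap.lsmul ℝ ℝ) volume,
    fun n => ⟨?_, hK.cthickening.of_isClosed_subset (isClosed_tsupport _) (ht n),
      (ht n).trans hδω⟩, fun n x hx => mollify_eq_zero (b n) hk0 (hb n) hx,
    fun n x hx => gradient_eq_zero_of_notMem_tsupport fun h' => hx (ht n h'),
    fun n x => norm_mollify_le (b n) hkC x, fun n x => ?_, ?_, ?_⟩
  · exact (b n).hasCompactSupport_normed.contDiff_convolution_left _ (b n).contDiff_normed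
      hk.locallyIntegrable
  · rw [gradient_mollify (b n) hk h]
    exact norm_mollify_le (b n) hMC x
  · exact ContDiffBump.ae_convolution_tendsto_right_of_locallyIntegrable hlim hratio
      hk.locallyIntegrable
  · filter_upwards [ContDiffBump.ae_convolution_tendsto_right_of_locallyIntegrable hlim hratio
      hM.locallyIntegrable] with x hx
    simpa only [gradient_mollify (b _) hk h] using hx

/-- The weak gradient may be tested with bounded compactly supported functions with bounded weak
gradient. -/
theorem HasWeakGrad.parts_of_bounded (hω : IsOpen ω) {u : Rd d → ℝ} {G : Rd d → Rd d}
    (hu : HasWeakGrad ω u G) {K : Set (Rd d)} (hK : IsCompact K) (hKω : K ⊆ ω)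
    {k : Rd d → ℝ} {M : Rd d → Rd d} (hk : Integrable k) (hM : Integrable M)
    (h : HasWeakGrad univ k M) (hk0 : ∀ x ∉ K, k x = 0) {C : ℝ}
    (hkC : ∀ x, ‖k x‖ ≤ C) (hMC : ∀ x, ‖M x‖ ≤ C) :
    ∫ x in ω, u x • M x = - ∫ x in ω, k x • G x := by
  obtain ⟨L, hL, hLω, η, hη, h0, h0', hb, hb', ht, ht'⟩ :=
    exists_test_approx hω hK hKω hk hM h hk0 hkC hMC
  have hC : 0 ≤ C := (norm_nonneg _).trans (hkC 0)
  have dom : ∀ {F : Type} [NormedAddCommGroup F] {f : Rd d → F}, LocallyIntegrableOn f ω →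
      Integrable (fun x => C * L.indicator (fun x => ‖f x‖) x) (volume.restrict ω) := by
    intro F _ f hf
    refine ((integrable_indicator_iff hL.measurableSet).2 ?_ |>.restrict).const_mul C
    exact (hf.integrableOn_compact_subset hLω hL).norm
  have l1 : Tendsto (fun n => ∫ x in ω, u x • gradient (η n) x) atTop
      (𝓝 (∫ x in ω, u x • M x)) := by
    refine tendsto_integral_of_dominated_convergence _
      (fun n => ((hη n).integrable_smul_grad hω hu.fun_loc).aestronglyMeasurable)
      (dom hu.fun_loc) (fun n => ae_of_all _ fun x => ?_) ?_
    · by_cases hx : x ∈ L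
      · rw [indicator_of_mem hx, norm_smul, mul_comm]
        exact mul_le_mul_of_nonneg_right (hb' n x) (norm_nonneg _)
      · simp [hx, h0' n x hx]
    · filter_upwards [ae_restrict_of_ae ht'] with x hx using hx.const_smul _
  have l2 : Tendsto (fun n => ∫ x in ω, η n x • G x) atTop (𝓝 (∫ x in ω, k x • G x)) := by
    refine tendsto_integral_of_dominated_convergence _
      (fun n => ((hη n).integrable_smul hω hu.grad_loc).aestronglyMeasurable)
      (dom hu.grad_loc) (fun n => ae_of_all _ fun x => ?_) ?_
    · by_cases hx : x ∈ L
      · rw [indicator_of_mem hx, norm_smul]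
        exact mul_le_mul_of_nonneg_right (hb n x) (norm_nonneg _)
      · simp [hx, h0 n x hx]
    · filter_upwards [ae_restrict_of_ae ht] with x hx using hx.smul_const _
  refine tendsto_nhds_unique l1 (l2.neg.congr fun n => ?_)
  rw [(hu.parts (η n) (hη n))]

/-- The product of a weakly differentiable function on `ω` and a test function is weakly
differentiable on the whole space. -/
theorem HasWeakGrad.test_mul (hω : IsOpen ω) {w φ : Rd d → ℝ} {H : Rd d → Rd d}
    (hw : HasWeakGrad ω w H) (hφ : IsTest ω φ) :
    HasWeakGrad univ (fun x => φ x * w x) (fun x => φ x • H x + w x • gradient φ x) where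
  fun_loc := by
    refine (Integrable.locallyIntegrable ?_).locallyIntegrableOn _
    exact (integrableOn_iff_integrable_of_support_subset fun x hx => by
      by_contra hx'; simp [hφ.eq_zero hx'] at hx).1 (hφ.integrable_smul hω hw.fun_loc)
  grad_loc := by
    refine (Integrable.locallyIntegrable ?_).locallyIntegrableOn _
    exact (integrableOn_iff_integrable_of_support_subset fun x hx => by
      by_contra hx'; simp [hφ.eq_zero hx', hφ.gradient_eq_zero hx'] at hx).1
        ((hφ.integrable_smul hω hw.grad_loc).add (hφ.integrable_smul_grad hω hw.fun_loc))
  parts η hη := by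
    have hφη : IsTest ω (fun x => φ x * η x) :=
      ⟨hφ.smooth.mul hη.smooth, hφ.compact.mul_right,
        (tsupport_mul_subset_left).trans hφ.subset⟩
    have hp := hw.parts _ hφη
    simp only [Measure.restrict_univ]
    rw [← setIntegral_eq_integral_of_forall_compl_eq_zero (s := ω) (μ := volume)
        (fun x hx => by simp [hφ.eq_zero hx]),
      ← setIntegral_eq_integral_of_forall_compl_eq_zero (s := ω) (μ := volume)
        (fun x hx => by simp [hφ.eq_zero hx, hφ.gradient_eq_zero hx])]
    have i1 : IntegrableOn (fun x => w x • (η x • gradient φ x)) ω := by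
      obtain ⟨C, hC⟩ := (hφ.compact_grad.smul_left (f := η)).exists_bound_of_continuous
        (hη.continuous.smul hφ.continuous_grad)
      exact integrableOn_smul_of_support' hφ.compact.isCompact hφ.subset hω hw.fun_loc
        (hη.continuous.smul hφ.continuous_grad).aestronglyMeasurable hC
        fun x hx => by simp [gradient_eq_zero_of_notMem_tsupport hx]
    have e1 : ∀ x, (φ x * w x) • gradient η x =
        w x • gradient (fun y => φ y * η y) x - w x • (η x • gradient φ x) := fun x => by
      rw [gradient_mul (hφ.contDiff_one.differentiable one_ne_zero x)
        (hη.contDiff_one.differentiable one_ne_zero x), smul_add, add_sub_cancel_right, smul_smul,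
        mul_comm]
    have e2 : ∀ x, η x • (φ x • H x + w x • gradient φ x) =
        (φ x * η x) • H x + w x • (η x • gradient φ x) := fun x => by
      rw [smul_add, smul_smul, mul_comm (η x), smul_comm (η x)]
    simp only [e1, e2]
    rw [integral_sub (hφη.integrable_smul_grad hω hw.fun_loc) i1,
      integral_add (hφη.integrable_smul hω hw.grad_loc) i1, hp]
    abel

/-- For a test function `φ`, the function `φ w` has compact support and is bounded with bounded weak
gradient, so `u` may be integrated by parts against it. No bound on `G` is needed. -/
theorem HasWeakGrad.mul_of_bounded (hω : IsOpen ω) {u w : Rd d → ℝ} {G H : Rd d → Rd d}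
    (hu : HasWeakGrad ω u G) (hw : HasWeakGrad ω w H)
    (hum : AEStronglyMeasurable u (volume.restrict ω))
    (hwm : AEStronglyMeasurable w (volume.restrict ω))
    {C : ℝ} (huC : ∀ x, ‖u x‖ ≤ C) (hwC : ∀ x, ‖w x‖ ≤ C) (hHC : ∀ x, ‖H x‖ ≤ C) :
    HasWeakGrad ω (fun x => u x * w x) (fun x => u x • H x + w x • G x) := by
  have hC : 0 ≤ C := (norm_nonneg _).trans (huC 0)
  have smul_loc : ∀ {F : Type} [NormedAddCommGroup F] [NormedSpace ℝ F] {f : Rd d → F}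
      {g : Rd d → ℝ}, LocallyIntegrableOn f ω → AEStronglyMeasurable g (volume.restrict ω) →
      (∀ x, ‖g x‖ ≤ C) → LocallyIntegrableOn (fun x => g x • f x) ω := by
    intro F _ _ f g hf hg hgC
    rw [locallyIntegrableOn_iff hω.isLocallyClosed] at hf ⊢
    intro k hk hkc
    exact (hf k hk hkc).bdd_smul C (hg.mono_measure (Measure.restrict_mono hk le_rfl))
      (ae_of_all _ hgC)
  refine ⟨smul_loc hw.fun_loc hum huC,
    (smul_loc hw.grad_loc hum huC).add (smul_loc hu.grad_loc hwm hwC), fun φ hφ => ?_⟩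
  have hk := hw.test_mul hω hφ
  obtain ⟨A, hA⟩ := hφ.bounded
  obtain ⟨B, hB⟩ := hφ.bounded_grad
  have hA0 : 0 ≤ A := (norm_nonneg _).trans (hA 0)
  have hB0 : 0 ≤ B := (norm_nonneg _).trans (hB 0)
  have key := hu.parts_of_bounded hω hφ.compact.isCompact hφ.subset
    (k := fun x => φ x * w x) (M := fun x => φ x • H x + w x • gradient φ x)
    ((integrableOn_iff_integrable_of_support_subset fun x hx => by
      by_contra hx'; simp [hφ.eq_zero hx'] at hx).1 (hφ.integrable_smul hω hw.fun_loc))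
    ((integrableOn_iff_integrable_of_support_subset fun x hx => by
      by_contra hx'; simp [hφ.eq_zero hx', hφ.gradient_eq_zero hx'] at hx).1
        ((hφ.integrable_smul hω hw.grad_loc).add (hφ.integrable_smul_grad hω hw.fun_loc)))
    hk (fun x hx => by simp [image_eq_zero_of_notMem_tsupport hx]) (C := A * C + C * B)
    (fun x => by
      rw [norm_mul]
      exact (mul_le_mul (hA x) (hwC x) (norm_nonneg _) hA0).trans
        (le_add_of_nonneg_right (by positivity)))
    (fun x => by
      refine (norm_add_le _ _).trans (add_le_add ?_ ?_) <;> rw [norm_smul]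
      · exact mul_le_mul (hA x) (hHC x) (norm_nonneg _) hA0
      · exact mul_le_mul (hwC x) (hB x) (norm_nonneg _) hC)
  have i1 : IntegrableOn (fun x => φ x • (u x • H x)) ω :=
    hφ.integrable_smul hω (smul_loc hw.grad_loc hum huC)
  have i2 : IntegrableOn (fun x => φ x • (w x • G x)) ω :=
    hφ.integrable_smul hω (smul_loc hu.grad_loc hwm hwC)
  have i3 : IntegrableOn (fun x => (u x * w x) • gradient φ x) ω :=
    hφ.integrable_smul_grad hω (smul_loc hw.fun_loc hum huC)
  have e1 : ∀ x, u x • (φ x • H x + w x • gradient φ x) =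
      φ x • (u x • H x) + (u x * w x) • gradient φ x := fun x => by
    rw [smul_add, smul_comm, smul_smul (u x)]
  have e2 : ∀ x, (φ x * w x) • G x = φ x • (w x • G x) := fun x => mul_smul _ _ _
  simp only [e1, e2] at key
  rw [integral_add i1 i3] at key
  simp only [smul_add]
  rw [integral_add i1 i2, neg_add, ← key]
  abel

/-- Essentially bounded functions agree almost everywhere with bounded ones. -/
theorem exists_bounded_rep {F : Type*} [NormedAddCommGroup F] {f : Rd d → F}
    (hf : MemLp f ⊤ (volume.restrict ω)) :
    ∃ g : Rd d → F, f =ᵐ[volume.restrict ω] g ∧ ∃ C, ∀ x, ‖g x‖ ≤ C := by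
  classical
  obtain ⟨C, hC⟩ : ∃ C : ℝ, ∀ᵐ x ∂volume.restrict ω, ‖f x‖ ≤ C := by
    refine ⟨(eLpNormEssSup f (volume.restrict ω)).toReal, ?_⟩
    have hfin := hf.2
    rw [eLpNorm_exponent_top] at hfin
    filter_upwards [ae_le_eLpNormEssSup (f := f) (μ := volume.restrict ω)] with x hx
    rw [← toReal_enorm]
    exact ENNReal.toReal_mono hfin.ne hx
  refine ⟨fun x => if ‖f x‖ ≤ C then f x else 0, ?_, max C 0, fun x => ?_⟩
  · filter_upwards [hC] with x hx using by simp [hx]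
  · dsimp only
    split_ifs with h
    · exact h.trans (le_max_left _ _)
    · simp

/-- The product rule for essentially bounded functions with essentially bounded weak gradients. -/
theorem HasWeakGrad.mul (hω : IsOpen ω) {u w : Rd d → ℝ} {G H : Rd d → Rd d}
    (hu : HasWeakGrad ω u G) (hw : HasWeakGrad ω w H) (hub : MemLp u ⊤ (volume.restrict ω))
    (hwb : MemLp w ⊤ (volume.restrict ω)) (hHb : MemLp H ⊤ (volume.restrict ω)) :
    HasWeakGrad ω (fun x => u x * w x) (fun x => u x • H x + w x • G x) := by
  obtain ⟨u', hu', A, hA⟩ := exists_bounded_rep hub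
  obtain ⟨w', hw', B, hB⟩ := exists_bounded_rep hwb
  obtain ⟨H', hH', C, hC⟩ := exists_bounded_rep hHb
  have key := (hu.congr hω hu' ae_eq_rfl).mul_of_bounded hω (hw.congr hω hw' hH')
    (hub.1.congr hu') (hwb.1.congr hw') (C := max A (max B C))
    (fun x => (hA x).trans (by simp)) (fun x => (hB x).trans (by simp))
    (fun x => (hC x).trans (by simp))
  refine key.congr hω ?_ ?_
  · filter_upwards [hu', hw'] with x h1 h2 using by rw [h1, h2]
  · filter_upwards [hu', hw', hH'] with x h1 h2 h3 using by rw [h1, h2, h3]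

/-! ### Lipschitz domains and parametrizations -/

/-- Each line in direction `ν` meets the graph in a single point; Fubini along this direction
concludes. -/
theorem volume_graph_eq_zero {ν : Rd d} (hν : ‖ν‖ = 1) {γ : Rd d → ℝ} (hγ : Continuous γ) :
    volume {y : Rd d | γ (y - (inner ℝ ν y : ℝ) • ν) = inner ℝ ν y} = 0 := by
  have hcl : IsClosed {y : Rd d | γ (y - (inner ℝ ν y : ℝ) • ν) = inner ℝ ν y} :=
    isClosed_eq (by fun_prop) (by fun_prop)
  have key := ae_mem_of_ae_add_linearMap_mem (LinearMap.toSpanSingleton ℝ (Rd d) ν)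
    (volume : Measure ℝ) (volume : Measure (Rd d)) hcl.measurableSet.compl fun y => by
      have hfin : ({γ (y - (inner ℝ ν y : ℝ) • ν) - inner ℝ ν y} : Set ℝ)ᶜ ∈ ae volume :=
        compl_mem_ae_iff.2 (by simp)
      filter_upwards [hfin] with t ht hmem
      refine ht ?_
      have hin : (inner ℝ ν (y + t • ν) : ℝ) = inner ℝ ν y + t := by
        rw [inner_add_right, inner_smul_right, real_inner_self_eq_norm_sq, hν]; ring
      have hmem' : γ (y + t • ν - (inner ℝ ν (y + t • ν) : ℝ) • ν) = inner ℝ ν (y + t • ν) := hmem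
      have hpt : y + t • ν - (inner ℝ ν y + t) • ν = y - (inner ℝ ν y : ℝ) • ν := by
        rw [add_smul]; abel
      rw [hin, hpt] at hmem'
      rw [mem_singleton_iff, hmem']; ring
  simpa [ae_iff] using key

/-- Locally the boundary lies in the graph: being in the closure gives one inequality, not being in
the open set gives the other. -/
theorem IsLipschitzDomain.volume_frontier (h : IsLipschitzDomain ω) :
    volume (frontier ω) = 0 := by
  refine measure_null_of_locally_null _ fun x hx => ?_
  obtain ⟨r, hr, ν, hν, γ, ⟨K, hK⟩, hγ⟩ := h.graph x hx
  refine ⟨frontier ω ∩ Metric.ball x r,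
    inter_mem self_mem_nhdsWithin (mem_nhdsWithin_of_mem_nhds (Metric.ball_mem_nhds x hr)),
    measure_mono_null ?_ (volume_graph_eq_zero hν hK.continuous)⟩
  rintro y ⟨hyf, hyb⟩
  refine le_antisymm ?_ ?_
  · have hy : y ∈ closure (ω ∩ Metric.ball x r) := by
      rw [inter_comm]
      exact Metric.isOpen_ball.inter_closure ⟨hyb, frontier_subset_closure hyf⟩
    have hcl : IsClosed {y : Rd d | γ (y - (inner ℝ ν y : ℝ) • ν) ≤ inner ℝ ν y} := by
      have := hK.continuous
      exact isClosed_le (by fun_prop) (by fun_prop)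
    exact closure_minimal (fun z hz => ((hγ z hz.2).1 hz.1).le) hcl hy
  · have hyω : y ∉ ω := by
      rw [h.isOpen.frontier_eq] at hyf; exact hyf.2
    exact not_lt.1 fun hlt => hyω ((hγ y hyb).2 hlt)

/-- Lipschitz maps control Hausdorff measure, which in dimension `d` has the same null sets as
Lebesgue measure. -/
theorem volume_image_eq_zero_of_lipschitzOn {f : Rd d → Rd d} {s : Set (Rd d)} {K : NNReal}
    (hf : LipschitzOnWith K f s) (hs : volume s = 0) : volume (f '' s) = 0 := by
  have e : (Measure.hausdorffMeasure (Module.finrank ℝ (Rd d) : ℝ) : Measure (Rd d)) s = 0 :=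
    Measure.absolutelyContinuous_isAddHaarMeasure _ volume hs
  refine Measure.absolutelyContinuous_isAddHaarMeasure volume
    (Measure.hausdorffMeasure (Module.finrank ℝ (Rd d) : ℝ) : Measure (Rd d)) ?_
  have := hf.hausdorffMeasure_image_le (d := (Module.finrank ℝ (Rd d) : ℝ)) (Nat.cast_nonneg _)
  rwa [e, mul_zero, nonpos_iff_eq_zero] at this

namespace IsParametrization

variable {F : OpenPartialHomeomorph (Rd d) (Rd d)}

theorem isBounded_target (hF : IsParametrization F) : Bornology.IsBounded F.target := by
  obtain ⟨K, hK⟩ := hF.lipschitz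
  rw [← F.image_source_eq_target]
  rw [Metric.isBounded_iff]
  obtain ⟨C, hC⟩ := Metric.isBounded_iff.1 hF.domain.isBounded
  refine ⟨K * C, ?_⟩
  rintro _ ⟨x, hx, rfl⟩ _ ⟨y, hy, rfl⟩
  exact (hK.dist_le_mul x hx y hy).trans (mul_le_mul_of_nonneg_left (hC hx hy) K.2)

/-- The Jacobian determinant, transported to the physical domain, is positive almost everywhere. -/
theorem det_symm_pos (hF : IsParametrization F) :
    ∀ᵐ x ∂volume.restrict F.target, 0 < (fderiv ℝ F (F.symm x)).det := by
  obtain ⟨K, hK⟩ := hF.lipschitz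
  have h := hF.det_pos
  rw [ae_restrict_iff' F.open_source.measurableSet] at h
  rw [ae_restrict_iff' F.open_target.measurableSet]
  have hS : volume {y ∈ F.source | ¬ 0 < (fderiv ℝ F y).det} = 0 := by
    rw [ae_iff] at h
    refine measure_mono_null (fun y hy => ?_) h
    simpa using hy
  have := volume_image_eq_zero_of_lipschitzOn (hK.mono (sep_subset _ _)) hS
  rw [ae_iff]
  refine measure_mono_null (fun x hx => ?_) this
  obtain ⟨hx, hx'⟩ := Classical.not_imp.1 hx
  exact ⟨F.symm x, ⟨F.map_target hx, hx'⟩, F.right_inv hx⟩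

/-- The Lipschitz constant bounds the operator norm of the derivative, and the determinant is
bounded on a closed ball of operators. -/
theorem det_symm_bounded (hF : IsParametrization F) :
    ∃ C, ∀ x ∈ F.target, ‖(fderiv ℝ F (F.symm x)).det‖ ≤ C := by
  obtain ⟨K, hK⟩ := hF.lipschitz
  have hc : IsCompact (Metric.closedBall (0 : Rd d →L[ℝ] Rd d) K) := isCompact_closedBall _ _
  obtain ⟨C, hC⟩ := hc.exists_bound_of_continuousOn (f := fun A => A.det)
    ContinuousLinearMap.continuous_det.continuousOn
  refine ⟨C, fun x hx => hC _ ?_⟩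
  rw [mem_closedBall_zero_iff]
  exact norm_fderiv_le_of_lipschitzOn ℝ (F.open_source.mem_nhds (F.map_target hx)) hK

theorem det_symm_measurable (F : OpenPartialHomeomorph (Rd d) (Rd d)) :
    AEStronglyMeasurable (fun x => (fderiv ℝ F (F.symm x)).det) (volume.restrict F.target) := by
  have h1 : AEMeasurable F.symm (volume.restrict F.target) :=
    F.symm.continuousOn.aemeasurable F.open_target.measurableSet
  have h2 : Measurable fun y => (fderiv ℝ F y).det :=
    ContinuousLinearMap.continuous_det.measurable.comp (measurable_fderiv ℝ F)
  exact (h2.comp_aemeasurable h1).aestronglyMeasurable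

theorem det_memLp (hF : IsParametrization F) :
    MemLp (fun x => (fderiv ℝ F (F.symm x)).det) ⊤ (volume.restrict F.target) := by
  obtain ⟨C, hC⟩ := hF.det_symm_bounded
  exact memLp_top_of_bound (det_symm_measurable F) C
    ((ae_restrict_iff' F.open_target.measurableSet).2 (ae_of_all _ hC))

theorem det_mul_memLp (hF : IsParametrization F) (hω : ω ⊆ F.target) (q : L2 ω) :
    MemLp (fun x => (fderiv ℝ F (F.symm x)).det * q x) 2 (volume.restrict ω) := by
  have h := hF.det_memLp.mono_measure (Measure.restrict_mono hω le_rfl)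
  exact (Lp.memLp q).mul (r := 2) h

/-- Passing from a space to its test space amounts to multiplication by the transported Jacobian
determinant, which is nonzero almost everywhere. -/
theorem ae_eq_of_mem_testSpace (hF : IsParametrization F) (hω : ω ⊆ F.target)
    {qhat t : Rd d → ℝ} {q : L2 ω} (hq : scalarPiola F qhat =ᵐ[volume.restrict ω] q)
    (ht : t =ᵐ[volume.restrict ω] qhat ∘ F.symm) :
    t =ᵐ[volume.restrict ω] fun x => (fderiv ℝ F (F.symm x)).det * q x := by
  filter_upwards [hq, ht, ae_restrict_of_ae_restrict_of_subset hω hF.det_symm_pos] with x h1 h2 h3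
  rw [h2, ← h1, scalarPiola, mul_inv_cancel_left₀ h3.ne']
  rfl

theorem memLp_of_mem_testSpace (hF : IsParametrization F) (hω : ω ⊆ F.target) {Q : Set (L2 ω)}
    {t : Rd d → ℝ} (ht : t ∈ testSpace F ω Q) : MemLp t 2 (volume.restrict ω) := by
  obtain ⟨qhat, ⟨q, -, hq⟩, ht⟩ := ht
  exact (hF.det_mul_memLp hω q).ae_eq (hF.ae_eq_of_mem_testSpace hω hq ht).symm

theorem det_mul_mem_testSpace (hF : IsParametrization F) (q : L2 F.target) {Q : Set (L2 F.target)}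
    (hq : q ∈ Q) : (fun x => (fderiv ℝ F (F.symm x)).det * q x) ∈ testSpace F F.target Q := by
  have hright : ∀ᵐ x ∂volume.restrict F.target, F (F.symm x) = x :=
    (ae_restrict_iff' F.open_target.measurableSet).2 (ae_of_all _ fun x hx => F.right_inv hx)
  refine ⟨fun y => (fderiv ℝ F y).det * q (F y), ⟨q, hq, ?_⟩, ?_⟩
  · filter_upwards [hright, hF.det_symm_pos] with x h1 h2
    rw [scalarPiola, h1, inv_mul_cancel_left₀ h2.ne']
  · filter_upwards [hright] with x h1
    rw [Function.comp_apply, h1]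

end IsParametrization

/-! ### Patches -/

theorem isOpen_patch {D : Set (Rd d)} (hD : IsOpen D) (u : Rd d → ℝ) : IsOpen (patch D u) :=
  hD.inter isOpen_interior

theorem patch_subset (D : Set (Rd d)) (u : Rd d → ℝ) : patch D u ⊆ D := inter_subset_left

theorem eq_zero_of_notMem_patch {D : Set (Rd d)} (hD : IsOpen D) {u : Rd d → ℝ}
    (hu : ContinuousOn u D) {x : Rd d} (hx : x ∈ D) (hxp : x ∉ patch D u) : u x = 0 := by
  by_contra h
  refine hxp ⟨hx, mem_interior_iff_mem_nhds.2 ?_⟩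
  filter_upwards [hD.mem_nhds hx, (hu.continuousAt (hD.mem_nhds hx)).eventually_ne h] with y hy hy'
  exact subset_closure ⟨hy, hy'⟩

/-- Off the closure of the patch `v` vanishes on an open set, hence so does its gradient; what
remains is the boundary of the patch, a null set. -/
theorem HasWeakGrad.ae_eq_zero_off_patch {D : Set (Rd d)} (hD : IsOpen D) {u v : Rd d → ℝ}
    (hu : ContinuousOn u D) (hnull : volume (frontier (patch D u)) = 0) {G : Rd d → Rd d}
    (h : HasWeakGrad D v G) (h0 : ∀ x ∈ D, u x = 0 → v x = 0) :
    ∀ᵐ x ∂volume.restrict D, x ∉ patch D u → G x = 0 := by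
  have hop : IsOpen (D \ closure (patch D u)) := hD.sdiff isClosed_closure
  have h1 := (h.mono sdiff_subset).ae_eq_zero_of_eqOn_zero hop fun x hx =>
    h0 x hx.1 (eq_zero_of_notMem_patch hD hu hx.1 fun h' => hx.2 (subset_closure h'))
  rw [ae_restrict_iff' hop.measurableSet] at h1
  rw [ae_restrict_iff' hD.measurableSet]
  filter_upwards [h1, measure_eq_zero_iff_ae_notMem.1 hnull] with x hx hxf hxD hxp
  refine hx ⟨hxD, fun hc => hxf ?_⟩
  rw [(isOpen_patch hD u).frontier_eq]
  exact ⟨hc, hxp⟩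

/-- By continuity, exceeding an essential bound at one point would mean exceeding it on a set of
positive measure. -/
theorem exists_bound_of_continuousOn_of_memLp {D : Set (Rd d)} (hD : IsOpen D) {u : Rd d → ℝ}
    (hu : ContinuousOn u D) (hb : MemLp u ⊤ (volume.restrict D)) : ∃ C, ∀ x ∈ D, ‖u x‖ ≤ C := by
  obtain ⟨g, hg, C, hC⟩ := exists_bounded_rep hb
  refine ⟨C, fun x hx => not_lt.1 fun hlt => ?_⟩
  rw [EventuallyEq, ae_restrict_iff' hD.measurableSet] at hg
  have hnhds : ∀ᶠ y in 𝓝 x, y ∈ D ∧ C < ‖u y‖ :=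
    (hD.eventually_mem hx).and ((hu.continuousAt (hD.mem_nhds hx)).norm.eventually (lt_mem_nhds hlt))
  have hpos : 0 < volume {y | y ∈ D ∧ C < ‖u y‖} :=
    Measure.measure_pos_of_mem_nhds _ hnhds
  refine hpos.ne' (measure_mono_null (fun y hy => ?_) (ae_iff.1 hg))
  exact fun h => absurd (hC y) (not_le.2 (by rw [← h hy.1]; exact hy.2))

/-! ### Extension by zero of the local fluxes -/

/-- Inside the large patch, `w` is continuous and vanishes at `x`. Outside it, the zero extension of
`w` may jump, but it is bounded and `u` tends to zero. -/
theorem tendsto_extProd {Ω : Set (Rd d)} (hΩ : IsOpen Ω) {u w : Rd d → ℝ} (hu : ContinuousOn u Ω)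
    (hw : ContinuousOn w (patch Ω u)) (hwb : MemLp w ⊤ (volume.restrict (patch Ω u)))
    {x : Rd d} (hx : x ∈ Ω) (hxp : x ∉ smallPatch Ω u w) :
    Tendsto (extProd Ω u w) (𝓝 x) (𝓝 0) := by
  have hux := hu.continuousAt (hΩ.mem_nhds hx)
  by_cases hxa : x ∈ patch Ω u
  · have hp := (isOpen_patch hΩ u).mem_nhds hxa
    have hwx := hw.continuousAt hp
    have h0 := eq_zero_of_notMem_patch (isOpen_patch hΩ u) hw hxa hxp
    have := hux.tendsto.mul hwx.tendsto
    rw [h0, mul_zero] at this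
    refine this.congr' ?_
    filter_upwards [hp] with y hy
    simp [extProd, indicator_of_mem hy]
  · have h0 := eq_zero_of_notMem_patch hΩ hu hx hxa
    obtain ⟨C, hC⟩ := exists_bound_of_continuousOn_of_memLp (isOpen_patch hΩ u) hw hwb
    have hux' := hux.tendsto.norm.mul_const (max C 0)
    rw [h0, norm_zero, zero_mul] at hux'
    refine squeeze_zero_norm (fun y => ?_) hux'
    rw [extProd, norm_mul]
    refine mul_le_mul_of_nonneg_left ?_ (norm_nonneg _)
    by_cases hy : y ∈ patch Ω u
    · rw [indicator_of_mem hy]; exact (hC y hy).trans (le_max_left _ _)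
    · rw [indicator_of_notMem hy, norm_zero]; exact le_max_right _ _

theorem integrable_inner_L2V (v : L2V ω) {g : Rd d → Rd d} (hg : MemLp g 2 (volume.restrict ω)) :
    Integrable (fun x => inner ℝ (v x) (g x)) (volume.restrict ω) := by
  refine (L2.integrable_inner v (hg.toLp g) (𝕜 := ℝ)).congr ?_
  filter_upwards [hg.coeFn_toLp] with x hx
  rw [hx]

/-- This is the conformity of the extension by zero: `φ` has zero trace on the part of the boundary
where the flux is unconstrained, since that part lies outside `Ω`. -/
theorem integral_div_add_eq_zero {Ω : Set (Rd d)} (hΩ : IsOpen Ω) {u w : Rd d → ℝ}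
    (hu : ContinuousOn u Ω) (hw : ContinuousOn w (patch Ω u))
    (hwb : MemLp w ⊤ (volume.restrict (patch Ω u)))
    {p : FluxPair (smallPatch Ω u w)} (hp : p ∈ H0div Ω u w) {φ : Rd d → ℝ} (hφ : IsTest Ω φ) :
    ∫ x in smallPatch Ω u w, inner ℝ (p.1 x) (gradient φ x) =
      - ∫ x in smallPatch Ω u w, p.2 x * φ x := by
  have hop : IsOpen (smallPatch Ω u w) := isOpen_patch (isOpen_patch hΩ u) w
  have key := hp.2 _ (hφ.toLp_mem_H1 hop) (ae_of_all _ fun x hx => ?_)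
  · rw [← sub_eq_zero, sub_neg_eq_add, ← integral_add, ← key]
    · refine integral_congr_ae ?_
      filter_upwards [(hφ.memLp (smallPatch Ω u w)).coeFn_toLp,
        (hφ.memLp_grad (smallPatch Ω u w)).coeFn_toLp] with x h1 h2
      rw [h1, h2]
    · exact integrable_inner_L2V _ (hφ.memLp_grad _)
    · exact (Lp.memLp p.2).integrable_mul (hφ.memLp _)
  · have hxΩ : x ∉ Ω := fun hxΩ => by
      have hxp : x ∉ smallPatch Ω u w := by
        have := hx.1; rw [hop.frontier_eq] at this; exact this.2
      refine hx.2 ?_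
      unfold neumannPart
      split_ifs
      · exact hx.1
      · exact ⟨hx.1, (tendsto_extProd hΩ hu hw hwb hxΩ hxp).mono_left nhdsWithin_le_nhds⟩
    have hφx : ∀ᶠ y in 𝓝 x, φ y = 0 :=
      notMem_tsupport_iff_eventuallyEq.1 fun h => hxΩ (hφ.subset h)
    -- As `φ` vanishes on a ball around `x`, the averages that define the trace are zero for small
    -- radii.
    obtain ⟨ε, hε, hball⟩ := Metric.eventually_nhds_iff_ball.1 hφx
    refine tendsto_const_nhds.congr' ?_
    filter_upwards [Ioo_mem_nhdsGT hε] with r hr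
    refine (integral_eq_zero_of_ae ?_).symm
    refine Measure.ae_smul_measure ?_ _
    have h1 := ae_restrict_of_ae_restrict_of_subset
      (inter_subset_right : Metric.ball x r ∩ smallPatch Ω u w ⊆ _)
      (hφ.memLp (smallPatch Ω u w)).coeFn_toLp
    filter_upwards [h1, ae_restrict_mem (Metric.isOpen_ball.inter hop).measurableSet] with y hy hy'
    simp only [hy, hball y (Metric.ball_subset_ball hr.2.le hy'.1), abs_zero, Pi.zero_apply]

/-! ### The local sources -/

theorem setIntegral_eq_of_ae_zero_off {D D' : Set (Rd d)} (hD : IsOpen D)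
    (hs : D' ⊆ D) {g : Rd d → ℝ} (h : ∀ᵐ x ∂volume.restrict D, x ∉ D' → g x = 0) :
    ∫ x in D', g x = ∫ x in D, g x := by
  symm
  refine setIntegral_eq_of_subset_of_ae_sdiff_eq_zero hD.measurableSet.nullMeasurableSet hs ?_
  rw [ae_restrict_iff' hD.measurableSet] at h
  filter_upwards [h] with x hx hxD using hx hxD.1 hxD.2

theorem memLp_inner_of_top {v g : Rd d → Rd d} (hv : MemLp v 2 (volume.restrict ω))
    (hg : MemLp g ⊤ (volume.restrict ω)) :
    MemLp (fun x => (inner ℝ (v x) (g x) : ℝ)) 2 (volume.restrict ω) := by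
  obtain ⟨g', hgg, C, hC⟩ := exists_bounded_rep hg
  refine hv.of_le_mul (c := C) (hv.1.inner hg.1) ?_
  filter_upwards [hgg] with x hx
  rw [hx, mul_comm]
  exact (norm_inner_le_norm _ _).trans (mul_le_mul_of_nonneg_left (hC x) (norm_nonneg _))

theorem memLp_mul_of_top {v g : Rd d → ℝ} (hv : MemLp v 2 (volume.restrict ω))
    (hg : MemLp g ⊤ (volume.restrict ω)) : MemLp (fun x => v x * g x) 2 (volume.restrict ω) :=
  hg.mul (r := 2) hv

theorem integrable_mul_of_memLp {v g : Rd d → ℝ} (hv : MemLp v 2 (volume.restrict ω))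
    (hg : MemLp g 2 (volume.restrict ω)) :
    Integrable (fun x => v x * g x) (volume.restrict ω) :=
  hv.integrable_mul hg

theorem memLp_restrict_mono {F : Type*} [NormedAddCommGroup F] {D D' : Set (Rd d)} {p : ENNReal}
    {v : Rd d → F} (hv : MemLp v p (volume.restrict D)) (hs : D' ⊆ D) :
    MemLp v p (volume.restrict D') :=
  hv.mono_measure (Measure.restrict_mono hs le_rfl)

section LocalSource

variable {Ω : Set (Rd d)} {u w : Rd d → ℝ} {G H : Rd d → Rd d}

theorem hasWeakGrad_patch_mul (hΩ : IsOpen Ω) (hu : MemW1inf Ω u) (hG : HasWeakGrad Ω u G)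
    (hw : MemW1inf (patch Ω u) w)
    (hH : HasWeakGrad (patch Ω u) w H) (hHb : MemLp H ⊤ (volume.restrict (patch Ω u))) :
    HasWeakGrad (patch Ω u) (fun x => u x * w x) (fun x => u x • H x + w x • G x) :=
  (hG.mono (patch_subset Ω u)).mul (isOpen_patch hΩ u) hH
    (memLp_restrict_mono hu.bdd (patch_subset Ω u)) hw.bdd hHb

theorem memLp_wgrad (hω : IsOpen ω) (hG : HasWeakGrad ω u G)
    (hGb : MemLp G ⊤ (volume.restrict ω)) : MemLp (wgrad ω u) ⊤ (volume.restrict ω) :=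
  hGb.ae_eq (hG.wgrad_ae hω).symm

theorem memLp_localSource (hΩ : IsOpen Ω) (f : L2 Ω) (uh : GradPair Ω) (hu : MemW1inf Ω u)
    (hw : MemW1inf (patch Ω u) w) (r : GradPair (patch Ω u)) :
    MemLp (localSource Ω f uh u w r) 2 (volume.restrict (patch Ω u)) := by
  obtain ⟨G, hG, hGb⟩ := hu.grad
  obtain ⟨H, hH, hHb⟩ := hw.grad
  have hop := isOpen_patch hΩ u
  have hs := patch_subset Ω u
  have hub := memLp_restrict_mono hu.bdd hs
  have hGb' := memLp_restrict_mono hGb hs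
  refine ((memLp_mul_of_top (memLp_restrict_mono (Lp.memLp f) hs) ?_).sub
    (memLp_inner_of_top (memLp_restrict_mono (Lp.memLp uh.2) hs) ?_)).sub
    (memLp_inner_of_top (Lp.memLp r.2) (memLp_wgrad hop hH hHb))
  · exact hw.bdd.mul (r := ⊤) hub
  · refine memLp_wgrad hop (hasWeakGrad_patch_mul hΩ hu hG hw hH hHb) ?_
    exact (hHb.smul (r := ⊤) hub).add (hGb'.smul (r := ⊤) hw.bdd)

/-- Each term contains `w` or its gradient, and both vanish off the small patch. Integrals over
`ω_b` may thus be taken over `ω_a`, the domain of the weak gradients in `localSource`. -/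
theorem localSource_ae_eq_zero (hΩ : IsOpen Ω) (f : L2 Ω) (uh : GradPair Ω) (hu : MemW1inf Ω u)
    (hw : MemW1inf (patch Ω u) w) (hnull : volume (frontier (smallPatch Ω u w)) = 0)
    (r : GradPair (patch Ω u)) :
    ∀ᵐ x ∂volume.restrict (patch Ω u), x ∉ smallPatch Ω u w →
      localSource Ω f uh u w r x = 0 := by
  obtain ⟨G, hG, hGb⟩ := hu.grad
  obtain ⟨H, hH, hHb⟩ := hw.grad
  have hop := isOpen_patch hΩ u
  have hm := hasWeakGrad_patch_mul hΩ hu hG hw hH hHb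
  filter_upwards [hH.wgrad_ae hop, hm.wgrad_ae hop, ae_restrict_mem hop.measurableSet,
    hH.ae_eq_zero_off_patch hop hw.cont hnull fun x _ hx => hx] with x h1 h2 h3 h4 hx
  rw [localSource, h1, h2, h4 hx, eq_zero_of_notMem_patch hop hw.cont h3 hx]
  simp

/-- The Galerkin orthogonality, tested with a member of the global partition of unity. -/
theorem IsGalerkin.setIntegral_patch (hΩ : IsOpen Ω) {Vh : Submodule ℝ (GradPair Ω)} {f : L2 Ω}
    {uh : GradPair Ω} (huh : IsGalerkin Ω Vh f uh) (hu : MemW1inf Ω u) (hG : HasWeakGrad Ω u G)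
    (hnull : volume (frontier (patch Ω u)) = 0)
    (hmem : ∀ p ∈ H10 Ω, p.1 =ᵐ[volume.restrict Ω] u → p ∈ Vh) (h10 : MemH10 Ω u) :
    ∫ x in patch Ω u, f x * u x = ∫ x in patch Ω u, inner ℝ (uh.2 x) (G x) := by
  obtain ⟨p, hp, hpu⟩ := h10
  have hp2 : p.2 =ᵐ[volume.restrict Ω] G :=
    ((H10_subset_H1 hΩ hp).congr hΩ hpu ae_eq_rfl).unique hΩ hG
  have key := huh.2 p (hmem p hp hpu)
  rw [setIntegral_eq_of_ae_zero_off hΩ (patch_subset Ω u),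
    setIntegral_eq_of_ae_zero_off hΩ (patch_subset Ω u)]
  · calc ∫ x in Ω, f x * u x = ∫ x in Ω, f x * p.1 x :=
          integral_congr_ae (hpu.mono fun x hx => by simp only [hx])
      _ = ∫ x in Ω, inner ℝ (uh.2 x) (p.2 x) := key.symm
      _ = _ := integral_congr_ae (hp2.mono fun x hx => by simp only [hx])
  · filter_upwards [hG.ae_eq_zero_off_patch hΩ hu.cont hnull fun x _ hx => hx] with x hx hxp
    rw [hx hxp, inner_zero_right]
  · filter_upwards [ae_restrict_mem hΩ.measurableSet] with x hx hxp
    rw [eq_zero_of_notMem_patch hΩ hu.cont hx hxp, mul_zero]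

/-- The compatibility condition of the local problems on interior patches. -/
theorem integral_localSource_eq_zero (hΩ : IsOpen Ω) {Vh : Submodule ℝ (GradPair Ω)} {f : L2 Ω}
    {uh : GradPair Ω} (huh : IsGalerkin Ω Vh f uh) (hu : MemW1inf Ω u)
    (hw : MemW1inf (patch Ω u) w) (hnull : volume (frontier (patch Ω u)) = 0)
    (hnull' : volume (frontier (smallPatch Ω u w)) = 0)
    (hbdd : Bornology.IsBounded Ω)
    (hmem : ∀ p ∈ H10 Ω, p.1 =ᵐ[volume.restrict Ω] u → p ∈ Vh)
    {Va : Submodule ℝ (GradPair (patch Ω u))} {r : GradPair (patch Ω u)}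
    (hr : IsLifting Ω f uh u Va r) (hVa : (Va : Set (GradPair (patch Ω u))) ⊆ H1star Ω u)
    (hhat : ∃ v ∈ Va, ∃ c : ℝ, (¬ MemH10 Ω u → c = 0) ∧
      w =ᵐ[volume.restrict (patch Ω u)] fun x => v.1 x + c) :
    ∫ x in smallPatch Ω u w, localSource Ω f uh u w r x = 0 := by
  obtain ⟨v, hv, c, hc, hwv⟩ := hhat
  obtain ⟨G, hG, hGb⟩ := hu.grad
  obtain ⟨H, hH, hHb⟩ := hw.grad
  have hop := isOpen_patch hΩ u
  have hs := patch_subset Ω u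
  have hub := memLp_restrict_mono hu.bdd hs
  have hGb' := memLp_restrict_mono hGb hs
  have hG' := hG.mono hs
  have hf' := memLp_restrict_mono (Lp.memLp f) hs
  have huh' := memLp_restrict_mono (Lp.memLp uh.2) hs
  have hm := hasWeakGrad_patch_mul hΩ hu hG hw hH hHb
  have hmb : MemLp (fun x => u x • H x + w x • G x) ⊤ (volume.restrict (patch Ω u)) :=
    (hHb.smul (r := ⊤) hub).add (hGb'.smul (r := ⊤) hw.bdd)
  have : IsFiniteMeasure (volume.restrict (patch Ω u)) :=
    isFiniteMeasure_restrict.2 (hbdd.subset hs).measure_lt_top.ne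
  -- `v` and `w` differ by a constant, so they share their gradient.
  have hv1 : HasWeakGrad (patch Ω u) w v.2 := by
    have h1 := (hVa hv).1
    have h2 := h1.add hop (hasWeakGrad_const c _)
    exact h2.congr hop hwv.symm (ae_of_all _ fun x => add_zero _)
  have hv2 : v.2 =ᵐ[volume.restrict (patch Ω u)] H := hv1.unique hop hH
  have hvu : HasWeakGrad (patch Ω u) (fun y => v.1 y * u y)
      (fun x => (u x • H x + w x • G x) + (-c) • G x) := by
    refine (hm.add hop (hG'.const_mul (-c))).congr hop ?_ ae_eq_rfl
    filter_upwards [hwv] with x hx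
    rw [hx]; ring
  have key := hr.2 v hv
  have e1 : ∫ x in patch Ω u, inner ℝ (r.2 x) (v.2 x) =
      ∫ x in patch Ω u, inner ℝ (r.2 x) (H x) :=
    integral_congr_ae (hv2.mono fun x hx => by simp only [hx])
  have e2 : ∫ x in patch Ω u, f x * (v.1 x * u x) =
      (∫ x in patch Ω u, f x * (u x * w x)) - c * ∫ x in patch Ω u, f x * u x := by
    rw [← integral_const_mul, ← integral_sub]
    · refine integral_congr_ae (hwv.mono fun x hx => ?_)
      simp only [hx]; ring
    · exact (memLp_mul_of_top hf' (hw.bdd.mul (r := ⊤) hub)).integrable one_le_two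
    · exact ((memLp_mul_of_top hf' hub).integrable one_le_two).const_mul c
  have e3 : ∫ x in patch Ω u, inner ℝ (uh.2 x) (wgrad (patch Ω u) (fun y => v.1 y * u y) x) =
      (∫ x in patch Ω u, inner ℝ (uh.2 x) (u x • H x + w x • G x)) -
        c * ∫ x in patch Ω u, inner ℝ (uh.2 x) (G x) := by
    rw [← integral_const_mul, ← integral_sub]
    · refine integral_congr_ae ((hvu.wgrad_ae hop).mono fun x hx => ?_)
      simp only [hx, inner_add_right, inner_smul_right]; ring
    · exact (memLp_inner_of_top huh' hmb).integrable one_le_two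
    · exact ((memLp_inner_of_top huh' hGb').integrable one_le_two).const_mul c
  -- The constant enters the lifting equation only through the Galerkin residual of `ψ_a`. This is
  -- zero if `ψ_a ∈ H₀¹(Ω)`, and otherwise `c = 0`.
  have e4 : c * ∫ x in patch Ω u, f x * u x =
      c * ∫ x in patch Ω u, inner ℝ (uh.2 x) (G x) := by
    by_cases h10 : MemH10 Ω u
    · rw [huh.setIntegral_patch hΩ hu hG hnull hmem h10]
    · rw [hc h10, zero_mul, zero_mul]
  have e5 : ∫ x in patch Ω u, localSource Ω f uh u w r x =
      (∫ x in patch Ω u, f x * (u x * w x)) -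
      (∫ x in patch Ω u, inner ℝ (uh.2 x) (u x • H x + w x • G x)) -
      ∫ x in patch Ω u, inner ℝ (r.2 x) (H x) := by
    have i1 : IntegrableOn (fun x => f x * (u x * w x)) (patch Ω u) :=
      (memLp_mul_of_top hf' (hw.bdd.mul (r := ⊤) hub)).integrable one_le_two
    have i2 := (memLp_inner_of_top huh' hmb).integrable one_le_two
    have i3 := (memLp_inner_of_top (Lp.memLp r.2) hHb).integrable one_le_two
    have i12 : IntegrableOn (fun x => f x * (u x * w x) -
        inner ℝ (uh.2 x) (u x • H x + w x • G x)) (patch Ω u) := i1.sub i2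
    rw [← integral_sub i1 i2, ← integral_sub i12 i3]
    refine integral_congr_ae ?_
    filter_upwards [hm.wgrad_ae hop, hH.wgrad_ae hop] with x h1 h2
    simp only [localSource, h1, h2]
  rw [setIntegral_eq_of_ae_zero_off hop (patch_subset _ _)
    (localSource_ae_eq_zero hΩ f uh hu hw hnull' r), e5]
  rw [e1, e2, e3] at key
  linarith

end LocalSource

/-! ### Summation of the local sources -/

theorem sum_localSource {Ω : Set (Rd d)} (hΩ : IsOpen Ω) {u : Rd d → ℝ} {G : Rd d → Rd d}
    {ι : Type*} [Fintype ι] {χ : ι → Rd d → ℝ} (f : L2 Ω) (uh : GradPair Ω)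
    (hu : MemW1inf Ω u) (hG : HasWeakGrad Ω u G) (hχ : ∀ b, MemW1inf (patch Ω u) (χ b))
    (hsum : ∀ x ∈ patch Ω u, ∑ b, χ b x = 1) (r : GradPair (patch Ω u)) :
    ∀ᵐ x ∂volume.restrict (patch Ω u),
      ∑ b, localSource Ω f uh u (χ b) r x = f x * u x - inner ℝ (uh.2 x) (G x) := by
  choose H hH hHb using fun b => (hχ b).grad
  have hop := isOpen_patch hΩ u
  have hs := patch_subset Ω u
  have hm := fun b => hasWeakGrad_patch_mul hΩ hu hG (hχ b) (hH b) (hHb b)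
  -- The gradients of a partition of unity sum to the gradient of the constant 1. This removes the
  -- lifting `r` from the sum.
  have s1 : ∀ᵐ x ∂volume.restrict (patch Ω u), ∑ b, H b x = 0 := by
    refine (HasWeakGrad.sum hop Finset.univ fun b _ => hH b).unique hop
      ((hasWeakGrad_const 1 _).congr hop ?_ ae_eq_rfl)
    exact (ae_restrict_iff' hop.measurableSet).2 (ae_of_all _ fun x hx => (hsum x hx).symm)
  have h1 : ∀ᵐ x ∂volume.restrict (patch Ω u), ∀ b, wgrad (patch Ω u) (χ b) x = H b x :=
    ae_all_iff.2 fun b => (hH b).wgrad_ae hop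
  have h2 : ∀ᵐ x ∂volume.restrict (patch Ω u), ∀ b,
      wgrad (patch Ω u) (fun y => u y * χ b y) x = u x • H b x + χ b x • G x :=
    ae_all_iff.2 fun b => (hm b).wgrad_ae hop
  filter_upwards [s1, h1, h2, ae_restrict_mem hop.measurableSet] with x h0 h1 h2 hx
  simp only [localSource, h1, h2, Finset.sum_sub_distrib, ← inner_sum, Finset.sum_add_distrib,
    ← Finset.smul_sum, ← Finset.sum_smul, ← Finset.mul_sum, h0, hsum x hx]
  simp

theorem sum_sum_integral_localSource {Ω : Set (Rd d)} (hΩ : IsOpen Ω) {α : Type*} [Fintype α]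
    {β : α → Type*} [∀ a, Fintype (β a)] {ψ : α → Rd d → ℝ} {χ : ∀ a, β a → Rd d → ℝ}
    (f : L2 Ω) (uh : GradPair Ω)
    (hψ : ∀ a, MemW1inf Ω (ψ a)) (hψsum : ∀ x ∈ Ω, ∑ a, ψ a x = 1)
    (hψnull : ∀ a, volume (frontier (patch Ω (ψ a))) = 0)
    (hχ : ∀ a b, MemW1inf (patch Ω (ψ a)) (χ a b))
    (hχsum : ∀ a, ∀ x ∈ patch Ω (ψ a), ∑ b, χ a b x = 1)
    (hχnull : ∀ a b, volume (frontier (smallPatch Ω (ψ a) (χ a b))) = 0)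
    (r : ∀ a, GradPair (patch Ω (ψ a))) {t : Rd d → ℝ} (ht : MemLp t 2 (volume.restrict Ω)) :
    ∑ a, ∑ b, ∫ x in smallPatch Ω (ψ a) (χ a b),
      localSource Ω f uh (ψ a) (χ a b) (r a) x * t x = ∫ x in Ω, f x * t x := by
  choose G hG hGb using fun a => (hψ a).grad
  have s0 : ∀ᵐ x ∂volume.restrict Ω, ∑ a, G a x = 0 := by
    refine (HasWeakGrad.sum hΩ Finset.univ fun b _ => hG b).unique hΩ
      ((hasWeakGrad_const 1 _).congr hΩ ?_ ae_eq_rfl)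
    exact (ae_restrict_iff' hΩ.measurableSet).2 (ae_of_all _ fun x hx => (hψsum x hx).symm)
  have inner_step : ∀ a, ∑ b, ∫ x in smallPatch Ω (ψ a) (χ a b),
      localSource Ω f uh (ψ a) (χ a b) (r a) x * t x =
      ∫ x in Ω, (f x * ψ a x - inner ℝ (uh.2 x) (G a x)) * t x := by
    intro a
    have hop := isOpen_patch hΩ (ψ a)
    have hs := patch_subset Ω (ψ a)
    have e1 : ∀ b, ∫ x in smallPatch Ω (ψ a) (χ a b),
        localSource Ω f uh (ψ a) (χ a b) (r a) x * t x =
        ∫ x in patch Ω (ψ a), localSource Ω f uh (ψ a) (χ a b) (r a) x * t x := fun b => by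
      refine setIntegral_eq_of_ae_zero_off hop (patch_subset _ _) ?_
      filter_upwards [localSource_ae_eq_zero hΩ f uh (hψ a) (hχ a b) (hχnull a b) (r a)]
        with x hx hxp
      rw [hx hxp, zero_mul]
    simp only [e1]
    rw [← integral_finsetSum _ fun b _ =>
      integrable_mul_of_memLp (memLp_localSource hΩ f uh (hψ a) (hχ a b) (r a))
        (memLp_restrict_mono ht hs)]
    rw [← setIntegral_eq_of_ae_zero_off hΩ hs]
    · refine integral_congr_ae ?_
      filter_upwards [sum_localSource hΩ f uh (hψ a) (hG a) (hχ a) (hχsum a) (r a)] with x hx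
      rw [← hx, Finset.sum_mul]
    · filter_upwards [(hG a).ae_eq_zero_off_patch hΩ (hψ a).cont (hψnull a) fun x _ hx => hx,
        ae_restrict_mem hΩ.measurableSet] with x h1 h2 hxp
      rw [h1 hxp, eq_zero_of_notMem_patch hΩ (hψ a).cont h2 hxp]
      simp
  simp only [inner_step]
  rw [← integral_finsetSum _ fun a _ => ?_]
  · refine integral_congr_ae ?_
    filter_upwards [s0, ae_restrict_mem hΩ.measurableSet] with x h1 h2
    rw [← Finset.sum_mul, Finset.sum_sub_distrib, ← Finset.mul_sum, ← inner_sum, h1, hψsum x h2]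
    simp
  · exact integrable_mul_of_memLp ((memLp_mul_of_top (Lp.memLp f) (hψ a).bdd).sub
      (memLp_inner_of_top (Lp.memLp uh.2) (hGb a))) ht

/-! ### Extension by zero -/

theorem memLp_indicator_of_subset {E : Type*} [NormedAddCommGroup E] {Ω : Set (Rd d)}
    (hω : IsOpen ω) (hs : ω ⊆ Ω) {v : Rd d → E} (hv : MemLp v 2 (volume.restrict ω)) :
    MemLp (ω.indicator v) 2 (volume.restrict Ω) := by
  rw [memLp_indicator_iff_restrict hω.measurableSet, Measure.restrict_restrict hω.measurableSet,
    inter_eq_self_of_subset_left hs]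
  exact hv

theorem setIntegral_indicator_inner {Ω : Set (Rd d)} (hω : IsOpen ω) (hΩ : IsOpen Ω) (hs : ω ⊆ Ω)
    (v g : Rd d → Rd d) :
    ∫ x in Ω, inner ℝ (ω.indicator v x) (g x) = ∫ x in ω, inner ℝ (v x) (g x) := by
  rw [← setIntegral_eq_of_ae_zero_off hΩ hs (ae_of_all _ fun x hx => by
    rw [indicator_of_notMem hx, inner_zero_left])]
  exact setIntegral_congr_fun hω.measurableSet fun x hx => by simp only [indicator_of_mem hx]

theorem setIntegral_indicator_mul {Ω : Set (Rd d)} (hω : IsOpen ω) (hΩ : IsOpen Ω) (hs : ω ⊆ Ω)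
    (v g : Rd d → ℝ) :
    ∫ x in Ω, ω.indicator v x * g x = ∫ x in ω, v x * g x := by
  rw [← setIntegral_eq_of_ae_zero_off hΩ hs (ae_of_all _ fun x hx => by
    rw [indicator_of_notMem hx, zero_mul])]
  exact setIntegral_congr_fun hω.measurableSet fun x hx => by simp only [indicator_of_mem hx]

/-- The sum of the divergences of the local fluxes, extended by zero. -/
def globalDiv {α : Type*} {β : α → Type*} [Fintype α] [∀ a, Fintype (β a)] (Ω : Set (Rd d))
    (ψ : α → Rd d → ℝ) (χ : ∀ a, β a → Rd d → ℝ)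
    (σ : ∀ a b, FluxPair (smallPatch Ω (ψ a) (χ a b))) : Rd d → ℝ :=
  fun x => ∑ a, ∑ b, (smallPatch Ω (ψ a) (χ a b)).indicator (σ a b).2 x

section Global

variable {α : Type*} {β : α → Type*} [Fintype α] [∀ a, Fintype (β a)] {Ω : Set (Rd d)}
  {ψ : α → Rd d → ℝ} {χ : ∀ a, β a → Rd d → ℝ}

theorem isOpen_smallPatch (hΩ : IsOpen Ω) (u w : Rd d → ℝ) : IsOpen (smallPatch Ω u w) :=
  isOpen_patch (isOpen_patch hΩ u) w

theorem smallPatch_subset (Ω : Set (Rd d)) (u w : Rd d → ℝ) : smallPatch Ω u w ⊆ Ω :=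
  (patch_subset _ _).trans (patch_subset _ _)

theorem memLp_globalFlux (hΩ : IsOpen Ω) (σ : ∀ a b, FluxPair (smallPatch Ω (ψ a) (χ a b))) :
    MemLp (globalFlux Ω ψ χ σ) 2 (volume.restrict Ω) :=
  memLp_finsetSum _ fun _ _ => memLp_finsetSum _ fun _ _ =>
    memLp_indicator_of_subset (isOpen_smallPatch hΩ _ _) (smallPatch_subset _ _ _) (Lp.memLp _)

theorem memLp_globalDiv (hΩ : IsOpen Ω) (σ : ∀ a b, FluxPair (smallPatch Ω (ψ a) (χ a b))) :
    MemLp (globalDiv Ω ψ χ σ) 2 (volume.restrict Ω) :=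
  memLp_finsetSum _ fun _ _ => memLp_finsetSum _ fun _ _ =>
    memLp_indicator_of_subset (isOpen_smallPatch hΩ _ _) (smallPatch_subset _ _ _) (Lp.memLp _)

theorem integral_globalDiv_mul (hΩ : IsOpen Ω) (σ : ∀ a b, FluxPair (smallPatch Ω (ψ a) (χ a b)))
    {t : Rd d → ℝ} (ht : MemLp t 2 (volume.restrict Ω)) :
    ∫ x in Ω, globalDiv Ω ψ χ σ x * t x =
      ∑ a, ∑ b, ∫ x in smallPatch Ω (ψ a) (χ a b), (σ a b).2 x * t x := by
  have hi : ∀ a b, Integrable (fun x => (smallPatch Ω (ψ a) (χ a b)).indicator (σ a b).2 x * t x)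
      (volume.restrict Ω) := fun a b =>
    integrable_mul_of_memLp (memLp_indicator_of_subset (isOpen_smallPatch hΩ _ _)
      (smallPatch_subset _ _ _) (Lp.memLp _)) ht
  simp only [globalDiv, Finset.sum_mul]
  rw [integral_finsetSum _ fun a _ => integrable_finsetSum _ fun b _ => hi a b]
  refine Finset.sum_congr rfl fun a _ => ?_
  rw [integral_finsetSum _ fun b _ => hi a b]
  exact Finset.sum_congr rfl fun b _ =>
    setIntegral_indicator_mul (isOpen_smallPatch hΩ _ _) hΩ (smallPatch_subset _ _ _) _ _

theorem integral_globalFlux_inner (hΩ : IsOpen Ω)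
    (σ : ∀ a b, FluxPair (smallPatch Ω (ψ a) (χ a b)))
    {g : Rd d → Rd d} (hg : MemLp g 2 (volume.restrict Ω)) :
    ∫ x in Ω, inner ℝ (globalFlux Ω ψ χ σ x) (g x) =
      ∑ a, ∑ b, ∫ x in smallPatch Ω (ψ a) (χ a b), inner ℝ ((σ a b).1 x) (g x) := by
  have hi : ∀ a b, Integrable
      (fun x => inner ℝ ((smallPatch Ω (ψ a) (χ a b)).indicator (σ a b).1 x) (g x))
      (volume.restrict Ω) := fun a b => by
    have hm := memLp_indicator_of_subset (isOpen_smallPatch hΩ (ψ a) (χ a b))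
      (smallPatch_subset _ _ _) (Lp.memLp (σ a b).1)
    refine (integrable_inner_L2V (hm.toLp _) hg).congr ?_
    filter_upwards [hm.coeFn_toLp] with x hx
    rw [hx]
  simp only [globalFlux, patchFlux, sum_inner]
  rw [integral_finsetSum _ fun a _ => integrable_finsetSum _ fun b _ => hi a b]
  refine Finset.sum_congr rfl fun a _ => ?_
  rw [integral_finsetSum _ fun b _ => hi a b]
  exact Finset.sum_congr rfl fun b _ =>
    setIntegral_indicator_inner (isOpen_smallPatch hΩ _ _) hΩ (smallPatch_subset _ _ _) _ _

end Global

/-! ### The divergence constraint against global test functions -/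

/-- The Piola transform of a constant `c` corresponds to the constant test function `c`, so the
enrichment is invisible to the mean-free functions `p` and `g`. -/
theorem integral_div_mul_eq_of_isProj {F : OpenPartialHomeomorph (Rd d) (Rd d)}
    (hF : IsParametrization F) {u w : Rd d → ℝ}
    {Q : Submodule ℝ (L2 (smallPatch F.target u w))}
    (hQ : (Q : Set (L2 (smallPatch F.target u w))) ⊆ L2star F.target u w)
    {g : Rd d → ℝ} (hg : MemLp g 2 (volume.restrict (smallPatch F.target u w)))
    (hg0 : MemH10 F.target (extProd F.target u w) → ∫ x in smallPatch F.target u w, g x = 0)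
    {p : L2 (smallPatch F.target u w)} (hp : IsProj F (smallPatch F.target u w) Q g p)
    {Qh : Set (L2 F.target)}
    (hQh : ∀ q ∈ Qh, ∃ q' ∈ enriched F u w (Q : Set (L2 (smallPatch F.target u w))),
      q =ᵐ[volume.restrict (smallPatch F.target u w)] q')
    {t : Rd d → ℝ} (ht : t ∈ testSpace F F.target Qh) :
    ∫ x in smallPatch F.target u w, p x * t x = ∫ x in smallPatch F.target u w, g x * t x := by
  have hs := smallPatch_subset F.target u w
  have htL := memLp_restrict_mono (hF.memLp_of_mem_testSpace subset_rfl ht) hs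
  obtain ⟨qhat, ⟨q, hq, hqq⟩, htq⟩ := ht
  obtain ⟨q', hq', hqq'⟩ := hQh q hq
  have h1 := ae_restrict_of_ae_restrict_of_subset hs hqq
  have h2 := ae_restrict_of_ae_restrict_of_subset hs htq
  unfold enriched at hq'
  split_ifs at hq' with h10
  · obtain ⟨q₀, hq₀, c, hc⟩ := hq'
    -- Removing the enriching constant leaves a test function of the local space, by linearity of
    -- the Piola transform.
    have ht₀ : (fun x => t x - c) ∈ testSpace F (smallPatch F.target u w)
        (Q : Set (L2 (smallPatch F.target u w))) := by
      refine ⟨fun y => qhat y - c, ⟨q₀, hq₀, ?_⟩, ?_⟩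
      · filter_upwards [h1, hqq', hc] with x e1 e2 e3
        have e4 : scalarPiola F (fun y => qhat y - c) x =
            scalarPiola F qhat x - scalarPiola F (fun _ => c) x := by
          simp only [scalarPiola]; ring
        rw [e4, e1, e2, e3, add_sub_cancel_right]
      · filter_upwards [h2] with x e1
        simp only [e1, Function.comp_apply]
    have : IsFiniteMeasure (volume.restrict (smallPatch F.target u w)) :=
      isFiniteMeasure_restrict.2 (hF.isBounded_target.subset hs).measure_lt_top.ne
    have split : ∀ v : Rd d → ℝ, MemLp v 2 (volume.restrict (smallPatch F.target u w)) →
        ∫ x in smallPatch F.target u w, v x = 0 →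
        ∫ x in smallPatch F.target u w, v x * t x =
          ∫ x in smallPatch F.target u w, v x * (t x - c) := by
      intro v hv hv0
      simp only [mul_sub]
      rw [integral_sub (integrable_mul_of_memLp hv htL) ((hv.integrable one_le_two).mul_const c),
        integral_mul_const, hv0, zero_mul, sub_zero]
    rw [split p (Lp.memLp p) (hQ hp.1 h10), split g hg (hg0 h10)]
    exact hp.2 _ ht₀
  · refine hp.2 t ⟨qhat, ⟨q', hq', ?_⟩, h2⟩
    filter_upwards [h1, hqq'] with x e1 e2
    rw [e1, e2]

/-- The Petrov–Galerkin projection is uniquely determined, in the case of a vanishing moment. -/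
theorem eq_zero_of_forall_testSpace {F : OpenPartialHomeomorph (Rd d) (Rd d)}
    (hF : IsParametrization F) {Q : Set (L2 F.target)} {p : L2 F.target} (hp : p ∈ Q)
    (h : ∀ t ∈ testSpace F F.target Q, ∫ x in F.target, p x * t x = 0) : p = 0 := by
  -- The test function belonging to `p` itself turns the hypothesis into a weighted `L²` norm with
  -- positive weight.
  have h0 := h _ (hF.det_mul_mem_testSpace p hp)
  have hi := integrable_mul_of_memLp (Lp.memLp p) (hF.det_mul_memLp subset_rfl p)
  rw [integral_eq_zero_iff_of_nonneg_ae ?_ hi] at h0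
  · rw [Lp.eq_zero_iff_ae_eq_zero]
    filter_upwards [h0, hF.det_symm_pos] with x h1 h2
    simpa [h2.ne'] using h1
  · filter_upwards [hF.det_symm_pos] with x h2
    have : p x * ((fderiv ℝ F (F.symm x)).det * p x) =
        (fderiv ℝ F (F.symm x)).det * (p x * p x) := by ring
    rw [this]
    exact mul_nonneg h2.le (mul_self_nonneg _)

end Equilibration

end

/-! ### Assembly of the global flux -/

theorem lemma7p5 {d : ℕ} (hd : d = 2 ∨ d = 3)
    {α : Type*} [Fintype α] {β : α → Type*} [∀ a, Fintype (β a)]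
    (F : OpenPartialHomeomorph (Rd d) (Rd d))
    (hF : IsParametrization F)
    (Vh : Submodule ℝ (GradPair F.target))
    (hVh : (Vh : Set (GradPair F.target)) ⊆ H10 F.target)
    (ψ : α → Rd d → ℝ)
    (hψ : IsGlobalPartition F.target ψ Vh)
    (χ : ∀ a, β a → Rd d → ℝ)
    (Va : ∀ a, Submodule ℝ (GradPair (patch F.target (ψ a))))
    (hχ : IsLocalPartition F.target ψ χ Va)
    (Q : ∀ a b, Submodule ℝ
      (L2 (smallPatch F.target (ψ a) (χ a b))))
    (V : ∀ a b, Submodule ℝ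
      (FluxPair (smallPatch F.target (ψ a) (χ a b))))
    (Qh : Submodule ℝ (L2 F.target))
    (hQV : IsCompatible F ψ χ Q V Qh)
    (f : L2 F.target)
    (uh : GradPair F.target)
    (huh : IsGalerkin F.target Vh f uh)
    (r : ∀ a, GradPair (patch F.target (ψ a)))
    (hr : ∀ a, IsLifting F.target f uh (ψ a) (Va a) (r a))
    (σ : ∀ a b, FluxPair (smallPatch F.target (ψ a) (χ a b)))
    (hσ : ∀ a b, IsLocalFlux F f uh (ψ a) (χ a b) (r a) (Q a b) (V a b) (σ a b)) :
    ∃ s ∈ Hdiv F.target,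
      s.1 =ᵐ[volume.restrict F.target] globalFlux F.target ψ χ σ ∧
      (∀ t ∈ testSpace F F.target (Qh : Set (L2 F.target)),
        ∫ x in F.target, s.2 x * t x = ∫ x in F.target, f x * t x) ∧
      (∀ p : L2 F.target,
        IsProj F F.target (Qh : Set (L2 F.target))
          (fun x => f x - s.2 x) p ↔ p = 0) := by
  have hΩ := F.open_target
  have hψnull := fun a => (hψ.patch_lipschitz a).volume_frontier
  have hχnull := fun a b => (hχ.patch_lipschitz a b).volume_frontier
  have hm1 := memLp_globalFlux hΩ σ
  have hm2 := memLp_globalDiv hΩ σ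
  have hdiv : ∀ t ∈ testSpace F F.target (Qh : Set (L2 F.target)),
      ∫ x in F.target, globalDiv F.target ψ χ σ x * t x = ∫ x in F.target, f x * t x := by
    intro t ht
    have htL := hF.memLp_of_mem_testSpace subset_rfl ht
    rw [integral_globalDiv_mul hΩ σ htL, ← sum_sum_integral_localSource hΩ f uh hψ.mem
      hψ.sum_eq_one hψnull hχ.mem hχ.sum_eq_one hχnull r htL]
    refine Finset.sum_congr rfl fun a _ => Finset.sum_congr rfl fun b _ => ?_
    refine integral_div_mul_eq_of_isProj hF (hQV.subset_Q a b)
      (memLp_restrict_mono (memLp_localSource hΩ f uh (hψ.mem a) (hχ.mem a b) (r a))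
        (patch_subset _ _)) (fun h10 => ?_) (hσ a b).2.1 (hQV.restrict_subset a b) ht
    exact integral_localSource_eq_zero hΩ huh (hψ.mem a) (hχ.mem a b) (hψnull a) (hχnull a b)
      hF.isBounded_target (hψ.interior_mem a) (hr a) (hχ.subset a) (hχ.hat_mem a b h10)
  have hdiv' : ∀ t ∈ testSpace F F.target (Qh : Set (L2 F.target)),
      ∫ x in F.target, hm2.toLp _ x * t x = ∫ x in F.target, f x * t x := fun t ht =>
    (integral_congr_ae (hm2.coeFn_toLp.mono fun x hx => by simp only [hx])).trans (hdiv t ht)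
  have hres : ∀ t ∈ testSpace F F.target (Qh : Set (L2 F.target)),
      ∫ x in F.target, (f x - hm2.toLp _ x) * t x = 0 := fun t ht => by
    have htL := hF.memLp_of_mem_testSpace subset_rfl ht
    simp only [sub_mul]
    rw [integral_sub (integrable_mul_of_memLp (Lp.memLp f) htL)
      (integrable_mul_of_memLp (Lp.memLp _) htL), hdiv' t ht, sub_self]
  -- The weak divergence of the global flux is the sum of the local divergences extended by zero.
  refine ⟨(hm1.toLp _, hm2.toLp _), fun φ hφ => ?_, hm1.coeFn_toLp, hdiv', fun p => ⟨?_, ?_⟩⟩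
  · have e1 : ∫ x in F.target, inner ℝ (hm1.toLp _ x) (gradient φ x) =
        ∫ x in F.target, inner ℝ (globalFlux F.target ψ χ σ x) (gradient φ x) :=
      integral_congr_ae (hm1.coeFn_toLp.mono fun x hx => by simp only [hx])
    have e2 : ∫ x in F.target, hm2.toLp _ x * φ x =
        ∫ x in F.target, globalDiv F.target ψ χ σ x * φ x :=
      integral_congr_ae (hm2.coeFn_toLp.mono fun x hx => by simp only [hx])
    rw [e1, e2, integral_globalFlux_inner hΩ σ (hφ.memLp_grad _),
      integral_globalDiv_mul hΩ σ (hφ.memLp _)]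
    simp only [← Finset.sum_neg_distrib]
    exact Finset.sum_congr rfl fun a _ => Finset.sum_congr rfl fun b _ =>
      integral_div_add_eq_zero hΩ (hψ.mem a).cont (hχ.mem a b).cont (hχ.mem a b).bdd
        (hQV.subset_V a b (hσ a b).1) hφ
  · rintro ⟨hp, hpt⟩
    exact eq_zero_of_forall_testSpace hF hp fun t ht => (hpt t ht).trans (hres t ht)
  · rintro rfl
    refine ⟨Qh.zero_mem, fun t ht => ?_⟩
    rw [hres t ht]
    refine integral_eq_zero_of_ae ?_
    filter_upwards [Lp.coeFn_zero ℝ 2 (volume.restrict F.target)] with x hx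
    simp only [hx, Pi.zero_apply, zero_mul]
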